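/- Let $N=(N(t))_{t\in\mathbb R}$ be a two-sided Poisson process with unit intensity, let $B$ be a random variable independent of $N$ with $\mathbb P(B=1)=\mathbb P(B=-1)=\tfrac12$, both defined on some probability space, and let $X(t)=B(-1)^{N(t)}$ for $t\in\mathbb R$. For a continuous function $W:\mathbb R\to\mathbb R$ and $T>0$ put \[ \mathcal Z(W,T)=\mathbb E\left[\exp\left(\int_{-T}^T\int_{-T}^T W(t-s)X(t)X(s)\,dt\,ds\right)\right]. \] Then there exist constants $\varepsilon>0$ and $C>0$ such that for every continuous and even $W\in L^1(\mathbb R)$ with $W\ge 0$ and $\|W\|_1\le\varepsilon$ all the integrals and expectations below are well defined and finite, $\mathcal Z(W,T)>0$ for all $T>0$, and \[ \limsup_{T\to\infty}\frac{1}{\mathcal Z(W,T)}\,\mathbb E\left[\frac1T\left(\int_{-T}^T X(t)\,dt\right)^2\exp\left(\int_{-T}^T\int_{-T}^T X(t)X(s)W(t-s)\,dt\,ds\right)\right]\le C . \] The constants $\varepsilon$ and $C$ do not depend on $W$ or on the probability space on which $N$ and $B$ are realized. -/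

import Mathlib

open MeasureTheory ProbabilityTheory Filter Topology

namespace JumpIsing

/-- `N` is a two-sided Poisson process with unit intensity on the probability space `(Ω, P)`:
it has independent increments, `N t - N s` is Poisson distributed with mean `t - s` for `s ≤ t`,
and almost every path vanishes at time `0`, is nondecreasing and right-continuous.
(The process takes values in `ℤ`, since it is nonpositive at negative times.) -/
structure IsTwoSidedPoisson {Ω : Type*} [MeasurableSpace Ω] (N : ℝ → Ω → ℤ)
    (P : Measure Ω) : Prop where
  measurable : ∀ t, Measurable (N t)
  indep_increments : HasIndepIncrements N P
  law_increment : ∀ s t : ℝ, s ≤ t →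
    HasLaw (fun ω => N t ω - N s ω)
      ((poissonMeasure (t - s).toNNReal).map (fun n : ℕ => (n : ℤ))) P
  path_zero : ∀ᵐ ω ∂P, N 0 ω = 0
  path_monotone : ∀ᵐ ω ∂P, Monotone (fun t => N t ω)
  path_rightContinuous : ∀ᵐ ω ∂P, ∀ t : ℝ, ContinuousWithinAt (fun s => N s ω) (Set.Ici t) t

/-- `B` is a random sign: `P(B = 1) = P(B = -1) = 1/2`. -/
structure IsRandomSign {Ω : Type*} [MeasurableSpace Ω] (B : Ω → ℝ) (P : Measure Ω) : Prop where
  measurable : Measurable B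
  prob_one : P {ω | B ω = 1} = 1 / 2
  prob_neg_one : P {ω | B ω = -1} = 1 / 2

/-- The jump process `X(t) = B (-1)^{N(t)}`. -/
noncomputable def jumpProcess {Ω : Type*} (N : ℝ → Ω → ℤ) (B : Ω → ℝ) (t : ℝ) (ω : Ω) : ℝ :=
  B ω * (-1 : ℝ) ^ (N t ω)

/-- The interaction `∫_{-T}^T ∫_{-T}^T W(t - s) X(t) X(s) ds dt`. -/
noncomputable def interaction {Ω : Type*} (W : ℝ → ℝ) (X : ℝ → Ω → ℝ) (T : ℝ) (ω : Ω) : ℝ :=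
  ∫ t in (-T)..T, ∫ s in (-T)..T, W (t - s) * X t ω * X s ω

/-- The partition function `Z(W, T)`. -/
noncomputable def partitionFunction {Ω : Type*} [MeasurableSpace Ω] (P : Measure Ω)
    (W : ℝ → ℝ) (X : ℝ → Ω → ℝ) (T : ℝ) : ℝ :=
  ∫ ω, Real.exp (interaction W X T ω) ∂P

/-- The random variable `(1/T) (∫_{-T}^T X(t) dt)² exp(∫∫ W(t - s) X(t) X(s) dt ds)`. -/
noncomputable def weightedSquare {Ω : Type*} (W : ℝ → ℝ) (X : ℝ → Ω → ℝ) (T : ℝ) (ω : Ω) : ℝ :=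
  1 / T * (∫ t in (-T)..T, X t ω) ^ 2 * Real.exp (interaction W X T ω)

/-- The magnetic susceptibility at volume `T` and zero magnetic field. -/
noncomputable def susceptibility {Ω : Type*} [MeasurableSpace Ω] (P : Measure Ω)
    (W : ℝ → ℝ) (X : ℝ → Ω → ℝ) (T : ℝ) : ℝ :=
  1 / partitionFunction P W X T * ∫ ω, weightedSquare W X T ω ∂P

end JumpIsing

/-! Sampled at equally spaced times with mesh `δ`, the process `X` is a stationary Ising chain: the
signs have joint weight proportional to `∏ (1 + a σ_i σ_{i+1})` with `a = exp (-2δ)`. The start is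
uniform because `B` is, and the step law comes from the parity of a Poisson variable. Replacing `X`
by its step function turns the double integral into a pair interaction `∑ K_ij σ_i σ_j` with `K ≥
0`, whose row sums are at most `δ ‖W‖₁`. It remains to bound the susceptibility of this ferromagnet
by a constant times `1/δ`, uniformly in the number of sites (`susc_le`, `sum_sq_chainWeight_le`).

That bound uses two consequences of the Griffiths inequalities: correlations increase with the
couplings (`corr_mono`), and erasing a bond `e` at `i` costs at most `t_e` times the susceptibility
at its other end (`susc_le_erase`). Let `M` be the largest susceptibility. Walking along the chain,
the weak bonds met at each site contribute at most `κ M` and each chain bond a factor `a`, so a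
one-sided walk gives the geometric series `(1 + κ M) / (1 - a)`. Two sides give `M ≤ 2 (1 + κ M) /
(1 - a)`. Here `1 - a` is of order `δ` and `κ` of order `δ ‖W‖₁`, so small `‖W‖₁` lets `M` be
absorbed, giving `M ≤ 4 / (1 - a)`.

Multiplying by `δ²` and by the number of sites, `2T / δ`, gives a bound `8 T` independent of the
mesh. Almost every path is right-continuous, so dominated convergence as the mesh shrinks carries
the bound to `X` itself, for every `T > 0`. -/

namespace JumpIsing

/-! ### Griffiths inequalities for real characters of a finite group. -/

section GKS

variable {G : Type*} [CommGroup G]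

/-- Functions on a group which are nonnegative combinations of real characters. -/
inductive IsCharSum : (G → ℝ) → Prop
  | char (c : ℝ) (hc : 0 ≤ c) (χ : G →* ℝ) : IsCharSum (fun g => c * χ g)
  | add {f h : G → ℝ} : IsCharSum f → IsCharSum h → IsCharSum (fun g => f g + h g)

lemma IsCharSum.mul {f h : G → ℝ} (hf : IsCharSum f) (hh : IsCharSum h) :
    IsCharSum (fun g => f g * h g) := by
  induction hf with
  | char c hc χ =>
    induction hh with
    | char d hd ψ =>
      convert IsCharSum.char (c * d) (mul_nonneg hc hd) (χ * ψ) using 2 with g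
      simp only [MonoidHom.mul_apply]; ring
    | add _ _ ih₁ ih₂ =>
      convert ih₁.add ih₂ using 2 with g
      ring
  | add _ _ ih₁ ih₂ =>
    convert ih₁.add ih₂ using 2 with g
    ring

lemma IsCharSum.const {c : ℝ} (hc : 0 ≤ c) : IsCharSum (fun _ : G => c) := by
  simpa using IsCharSum.char c hc (1 : G →* ℝ)

lemma IsCharSum.of_hom (χ : G →* ℝ) : IsCharSum (fun g => χ g) := by
  simpa using IsCharSum.char 1 zero_le_one χ

lemma IsCharSum.prod {E : Type*} (s : Finset E) {f : E → G → ℝ} (hf : ∀ e, IsCharSum (f e)) :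
    IsCharSum (fun g => ∏ e ∈ s, f e g) := by
  classical
  induction s using Finset.induction_on with
  | empty => simpa using IsCharSum.const (G := G) zero_le_one
  | insert e s he ih =>
    simp only [Finset.prod_insert he]
    exact (hf e).mul ih

/-- Orthogonality: a nontrivial character sums to zero and the trivial one to the order of the
group. This is the first Griffiths inequality. -/
lemma IsCharSum.sum_nonneg [Fintype G] {f : G → ℝ} (hf : IsCharSum f) : 0 ≤ ∑ g, f g := by
  classical
  induction hf with
  | char c hc χ =>
    rw [← Finset.mul_sum, sum_hom_units]
    split_ifs
    · positivity
    · simp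
  | add _ _ ih₁ ih₂ =>
    rw [Finset.sum_add_distrib]; exact add_nonneg ih₁ ih₂

lemma hom_sq_eq_one (hG : ∀ g : G, g * g = 1) (χ : G →* ℝ) (g : G) : χ g * χ g = 1 := by
  rw [← map_mul, hG, map_one]

lemma neg_one_le_hom (hG : ∀ g : G, g * g = 1) (χ : G →* ℝ) (g : G) : -1 ≤ χ g := by
  nlinarith [hom_sq_eq_one hG χ g]

lemma hom_le_one (hG : ∀ g : G, g * g = 1) (χ : G →* ℝ) (g : G) : χ g ≤ 1 := by
  nlinarith [hom_sq_eq_one hG χ g]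

variable {E : Type*} [Fintype E]

/-- The Boltzmann weight with bonds `χ e` of strength `t e`. -/
noncomputable def weight (χ : E → G →* ℝ) (t : E → ℝ) (g : G) : ℝ := ∏ e, (1 + t e * χ e g)

variable {χ : E → G →* ℝ} {t : E → ℝ}

lemma weight_nonneg (hG : ∀ g : G, g * g = 1) (ht : ∀ e, 0 ≤ t e) (ht' : ∀ e, t e ≤ 1) (g : G) :
    0 ≤ weight χ t g :=
  Finset.prod_nonneg fun e _ => by nlinarith [ht e, ht' e, neg_one_le_hom hG (χ e) g]

lemma weight_update [DecidableEq E] (e : E) (s : ℝ) (g : G) :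
    weight χ (Function.update t e s) g =
      (1 + s * χ e g) * weight χ (Function.update t e 0) g := by
  rw [weight, weight, ← Finset.mul_prod_erase _ _ (Finset.mem_univ e),
    ← Finset.mul_prod_erase _ (fun i => 1 + Function.update t e 0 i * χ i g) (Finset.mem_univ e)]
  simp only [Function.update_self, zero_mul, add_zero, one_mul]
  congr 1
  refine Finset.prod_congr rfl fun i hi => ?_
  rw [Function.update_of_ne (Finset.ne_of_mem_erase hi),
    Function.update_of_ne (Finset.ne_of_mem_erase hi)]

lemma update_mem_Icc {E : Type*} [DecidableEq E] {t : E → ℝ} {s : ℝ} (ht : ∀ e, t e ∈ Set.Icc (0 : ℝ) 1) (hs : s ∈ Set.Icc (0 : ℝ) 1)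
    (e e' : E) : Function.update t e s e' ∈ Set.Icc (0 : ℝ) 1 := by
  by_cases h : e' = e
  · subst h; simpa using hs
  · simpa [Function.update_of_ne h] using ht e'

variable [Fintype G]

/-- Unnormalized expectation of a character. -/
noncomputable def num (χ : E → G →* ℝ) (A : G →* ℝ) (t : E → ℝ) : ℝ :=
  ∑ g, A g * weight χ t g

lemma num_nonneg (A : G →* ℝ) (ht : ∀ e, 0 ≤ t e) : 0 ≤ num χ A t :=
  ((IsCharSum.of_hom A).mul (IsCharSum.prod _ fun e =>
    (IsCharSum.const zero_le_one).add (IsCharSum.char (t e) (ht e) (χ e)))).sum_nonneg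

lemma num_one_pos (hG : ∀ g : G, g * g = 1) (ht : ∀ e, 0 ≤ t e) (ht' : ∀ e, t e ≤ 1) :
    0 < num χ 1 t := by
  refine Finset.sum_pos' (fun g _ => ?_) ⟨1, Finset.mem_univ _, ?_⟩
  · simpa using weight_nonneg hG ht ht' g
  · simp only [one_mul, weight, map_one, mul_one]
    exact Finset.prod_pos fun e _ => by linarith [ht e]

/-- The second Griffiths inequality. -/
lemma num_mul_num_le (hG : ∀ g : G, g * g = 1) (ht : ∀ e, 0 ≤ t e) (ht' : ∀ e, t e ≤ 1)
    (A B : G →* ℝ) : num χ A t * num χ B t ≤ num χ (A * B) t * num χ 1 t := by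
  rw [← sub_nonneg]
  -- Ginibre's duplication: a pair of configurations is written as `(g, g * τ)`, and the two weights
  -- are multiplied bond by bond using `χ e g ^ 2 = 1`.
  have key : num χ (A * B) t * num χ 1 t - num χ A t * num χ B t =
      ∑ τ : G, ∑ g : G, (1 - B τ) * ((A * B) g * ∏ e,
        ((1 + t e ^ 2 * χ e τ) + t e * (1 + χ e τ) * χ e g)) := by
    have h1 : ∀ C : G →* ℝ, ∀ D : G →* ℝ, num χ C t * num χ D t =
        ∑ τ : G, ∑ g : G, (C g * D g) * D τ * (weight χ t g * weight χ t (g * τ)) := by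
      intro C D
      rw [num, num, Finset.sum_mul_sum]
      conv_rhs => rw [Finset.sum_comm]
      refine Finset.sum_congr rfl fun g _ => ?_
      rw [← Equiv.sum_comp (Equiv.mulLeft g)]
      refine Finset.sum_congr rfl fun τ _ => ?_
      simp only [Equiv.coe_mulLeft, map_mul]; ring
    rw [h1, h1, ← Finset.sum_sub_distrib]
    refine Finset.sum_congr rfl fun τ _ => ?_
    rw [← Finset.sum_sub_distrib]
    refine Finset.sum_congr rfl fun g _ => ?_
    have h2 : weight χ t g * weight χ t (g * τ) =
        ∏ e, ((1 + t e ^ 2 * χ e τ) + t e * (1 + χ e τ) * χ e g) := by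
      rw [weight, weight, ← Finset.prod_mul_distrib]
      refine Finset.prod_congr rfl fun e _ => ?_
      rw [map_mul]
      linear_combination (t e ^ 2 * χ e τ) * hom_sq_eq_one hG (χ e) g
    rw [h2]
    simp only [MonoidHom.mul_apply, MonoidHom.one_apply]
    ring
  rw [key]
  -- For fixed `τ` the factor `1 - B τ` is nonnegative, and the rest is a character sum in `g` whose
  -- coefficients are nonnegative because `|χ e τ| ≤ 1` and `0 ≤ t e ≤ 1`.
  refine Finset.sum_nonneg fun τ _ => ?_
  rw [← Finset.mul_sum]
  refine mul_nonneg (by linarith [hom_le_one hG B τ]) ?_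
  refine ((IsCharSum.of_hom (A * B)).mul (IsCharSum.prod _ fun e =>
    (IsCharSum.const ?_).add (IsCharSum.char _ ?_ (χ e)))).sum_nonneg
  · have := neg_one_le_hom hG (χ e) τ
    have h3 : t e ^ 2 ≤ 1 := by nlinarith [ht e, ht' e]
    nlinarith [sq_nonneg (t e)]
  · exact mul_nonneg (ht e) (by linarith [neg_one_le_hom hG (χ e) τ])

/-- Normalized expectation of a character. -/
noncomputable def corr (χ : E → G →* ℝ) (A : G →* ℝ) (t : E → ℝ) : ℝ := num χ A t / num χ 1 t

lemma corr_nonneg (A : G →* ℝ) (ht : ∀ e, 0 ≤ t e) : 0 ≤ corr χ A t :=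
  div_nonneg (num_nonneg _ ht) (num_nonneg _ ht)

variable [DecidableEq E]

lemma num_update (e : E) (s : ℝ) (A : G →* ℝ) :
    num χ A (Function.update t e s) =
      num χ A (Function.update t e 0) + s * num χ (A * χ e) (Function.update t e 0) := by
  simp only [num, weight_update e s, Finset.mul_sum, ← Finset.sum_add_distrib, MonoidHom.mul_apply]
  refine Finset.sum_congr rfl fun g _ => by ring

/-- The numerator is affine in `t e`, and removing the bond can only lower the denominator, by the
first Griffiths inequality. -/
lemma corr_update_le (hG : ∀ g : G, g * g = 1) (ht : ∀ e, t e ∈ Set.Icc (0 : ℝ) 1) (e : E)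
    (A : G →* ℝ) : corr χ A t ≤ corr χ A (Function.update t e 0)
      + t e * corr χ (A * χ e) (Function.update t e 0) := by
  have h0 := update_mem_Icc ht (Set.left_mem_Icc.2 zero_le_one) e
  have hz : 0 < num χ 1 (Function.update t e 0) :=
    num_one_pos hG (fun e => (h0 e).1) (fun e => (h0 e).2)
  have h1 := num_update (χ := χ) (t := t) e (t e) A
  have h2 := num_update (χ := χ) (t := t) e (t e) 1
  rw [Function.update_eq_self] at h1 h2
  have hA := num_nonneg (χ := χ) A (fun e => (h0 e).1)
  have hB := num_nonneg (χ := χ) (A * χ e) (fun e => (h0 e).1)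
  have hC := num_nonneg (χ := χ) (1 * χ e) (fun e => (h0 e).1)
  have hte := (ht e).1
  rw [corr, corr, corr, h1, h2, ← mul_div_assoc, ← add_div]
  exact div_le_div_of_nonneg_left (by positivity) hz (le_add_of_nonneg_right (by positivity))

/-- As a function of one coupling, the correlation is a ratio of affine functions. The sign of its
derivative is that of the determinant of the coefficients, which the second Griffiths inequality
controls. -/
lemma corr_update_mono (hG : ∀ g : G, g * g = 1) (ht : ∀ e, t e ∈ Set.Icc (0 : ℝ) 1) (e : E)
    (A : G →* ℝ) {s s' : ℝ} (hs : 0 ≤ s) (hss' : s ≤ s') :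
    corr χ A (Function.update t e s) ≤ corr χ A (Function.update t e s') := by
  have h0 := update_mem_Icc ht (Set.left_mem_Icc.2 zero_le_one) e
  have hz : 0 < num χ 1 (Function.update t e 0) :=
    num_one_pos hG (fun e => (h0 e).1) (fun e => (h0 e).2)
  have hC := num_nonneg (χ := χ) (1 * χ e) (fun e => (h0 e).1)
  have hg := num_mul_num_le (χ := χ) hG (fun e => (h0 e).1) (fun e => (h0 e).2) A (1 * χ e)
  rw [← mul_assoc, mul_one] at hg
  rw [corr, corr, num_update e s A, num_update e s 1, num_update e s' A, num_update e s' 1]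
  have hs' : 0 ≤ s' := hs.trans hss'
  rw [div_le_div_iff₀ (by positivity) (by positivity)]
  nlinarith [mul_nonneg (sub_nonneg.2 hss') (sub_nonneg.2 hg)]

lemma corr_mono (hG : ∀ g : G, g * g = 1) {t' : E → ℝ} (ht' : ∀ e, 0 ≤ t' e)
    (htt' : ∀ e, t' e ≤ t e) (ht : ∀ e, t e ≤ 1) (A : G →* ℝ) :
    corr χ A t' ≤ corr χ A t := by
  have h : ∀ s : Finset E, corr χ A t' ≤ corr χ A (s.piecewise t t') := by
    intro s
    induction s using Finset.induction_on with
    | empty => simp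
    | insert e s he ih =>
      refine ih.trans ?_
      rw [Finset.piecewise_insert]
      conv_lhs => rw [← Function.update_eq_self e (s.piecewise t t')]
      refine corr_update_mono hG (fun e' => ?_) e A ?_ ?_
      · by_cases h : e' ∈ s
        · simpa [h] using ⟨(ht' e').trans (htt' e'), ht e'⟩
        · simpa [h] using ⟨ht' e', (htt' e').trans (ht e')⟩
      · simpa [he] using ht' e
      · simpa [he] using htt' e
  simpa using h Finset.univ

end GKS

/-! ### Ising models on a finite multigraph and their susceptibility. -/

section Ising

variable {ι : Type*}

lemma sign_config_sq (g : ι → ℤˣ) : g * g = 1 := by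
  funext i; exact Int.units_mul_self _

/-- The spin at `x`, as a real character of the group of configurations. -/
noncomputable def spin (x : ι) : (ι → ℤˣ) →* ℝ :=
  ((Int.castRingHom ℝ : ℤ →* ℝ).comp (Units.coeHom ℤ)).comp (Pi.evalMonoidHom (fun _ => ℤˣ) x)

lemma spin_apply (x : ι) (g : ι → ℤˣ) : spin x g = ((g x : ℤ) : ℝ) := rfl

lemma spin_mul_self (x : ι) : spin x * spin x = 1 := by
  ext g
  exact hom_sq_eq_one sign_config_sq (spin x) g

variable {E : Type*} (u v : E → ι)

/-- The product of the two spins at the ends of a bond. -/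
noncomputable def bond (e : E) : (ι → ℤˣ) →* ℝ := spin (u e) * spin (v e)

/-- The bond `e` has `i` as an end. -/
def Touches (e : E) (i : ι) : Prop := u e = i ∨ v e = i

variable [DecidableEq ι]

instance (e : E) (i : ι) : Decidable (Touches u v e i) :=
  inferInstanceAs (Decidable (_ ∨ _))

/-- The end of `e` opposite to `i`. -/
def otherEnd (e : E) (i : ι) : ι := if u e = i then v e else u e

variable {u v}

lemma touches_otherEnd (e : E) (i : ι) : Touches u v e (otherEnd u v e i) := by
  unfold Touches otherEnd; split_ifs <;> simp

lemma spin_mul_bond {e : E} {i : ι} (h : Touches u v e i) :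
    spin i * bond u v e = spin (otherEnd u v e i) := by
  unfold otherEnd bond
  split_ifs with h1
  · subst h1; rw [← mul_assoc, spin_mul_self, one_mul]
  · obtain rfl : v e = i := h.resolve_left h1
    rw [mul_comm, mul_assoc, spin_mul_self, mul_one]

/-- The couplings `t` with those of the bonds in `F` removed. -/
def removeBonds [DecidableEq E] (F : Finset E) (t : E → ℝ) : E → ℝ := F.piecewise 0 t

lemma removeBonds_mem_Icc [DecidableEq E] {t : E → ℝ} (ht : ∀ e, t e ∈ Set.Icc (0 : ℝ) 1) (F : Finset E) (e : E) :
    removeBonds F t e ∈ Set.Icc (0 : ℝ) 1 := by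
  by_cases h : e ∈ F
  · simp [removeBonds, h]
  · simpa [removeBonds, h] using ht e

lemma removeBonds_le [DecidableEq E] {t : E → ℝ} (ht : ∀ e, 0 ≤ t e) (F : Finset E) (e : E) :
    removeBonds F t e ≤ t e := by
  by_cases h : e ∈ F
  · simpa [removeBonds, h] using ht e
  · simp [removeBonds, h]

variable [Fintype E]

lemma weight_flip {t : E → ℝ} {i : ι} (hi : ∀ e, Touches u v e i → t e = 0) (g : ι → ℤˣ) :
    weight (bond u v) t (Pi.mulSingle i (-1) * g) = weight (bond u v) t g := by
  refine Finset.prod_congr rfl fun e _ => ?_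
  by_cases h : Touches u v e i
  · rw [hi e h, zero_mul, zero_mul]
  · simp only [Touches, not_or] at h
    simp [bond, spin_apply, Pi.mulSingle_eq_of_ne h.1, Pi.mulSingle_eq_of_ne h.2]

variable [Fintype ι]

variable (u v) in
/-- The sum over `s` of the two-point functions of the spins at `i` and `s`. -/
noncomputable def susc (t : E → ℝ) (i : ι) : ℝ := ∑ s, corr (bond u v) (spin i * spin s) t

variable {t : E → ℝ}

lemma susc_nonneg (ht : ∀ e, 0 ≤ t e) (i : ι) : 0 ≤ susc u v t i :=
  Finset.sum_nonneg fun _ _ => corr_nonneg _ ht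

/-- Flipping the spin at the isolated site `i` preserves the weight and reverses the sign of `spin i
* spin s` for `s ≠ i`, so only `s = i` contributes. -/
lemma susc_eq_one (ht : ∀ e, t e ∈ Set.Icc (0 : ℝ) 1) {i : ι}
    (hi : ∀ e, Touches u v e i → t e = 0) : susc u v t i = 1 := by
  rw [susc, Finset.sum_eq_single i, spin_mul_self]
  · exact div_self (num_one_pos sign_config_sq (fun e => (ht e).1) (fun e => (ht e).2)).ne'
  · intro s _ hs
    have h : num (bond u v) (spin i * spin s) t = -num (bond u v) (spin i * spin s) t := by
      conv_lhs => rw [num, ← Equiv.sum_comp (Equiv.mulLeft (Pi.mulSingle i (-1)))]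
      rw [num, ← Finset.sum_neg_distrib]
      refine Finset.sum_congr rfl fun g _ => ?_
      rw [Equiv.coe_mulLeft, weight_flip hi]
      simp [spin_apply, Pi.mulSingle_eq_of_ne hs]
    have h0 : num (bond u v) (spin i * spin s) t = 0 := by linarith
    rw [corr, h0, zero_div]
  · simp

variable [DecidableEq E]

lemma susc_mono {t' : E → ℝ} (ht' : ∀ e, 0 ≤ t' e) (htt' : ∀ e, t' e ≤ t e) (ht : ∀ e, t e ≤ 1)
    (i : ι) : susc u v t' i ≤ susc u v t i :=
  Finset.sum_le_sum fun _ _ => corr_mono sign_config_sq ht' htt' ht _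

/-- The bond character cancels the spin at `i` and leaves the spin at the other end, so
`corr_update_le` summed over `s` closes up into susceptibilities. -/
lemma susc_le_erase (ht : ∀ e, t e ∈ Set.Icc (0 : ℝ) 1) {e : E} {i : ι}
    (h : Touches u v e i) : susc u v t i ≤ susc u v (Function.update t e 0) i +
      t e * susc u v (Function.update t e 0) (otherEnd u v e i) := by
  rw [susc, susc, susc, Finset.mul_sum, ← Finset.sum_add_distrib]
  refine Finset.sum_le_sum fun s _ => (corr_update_le sign_config_sq ht e _).trans_eq ?_
  rw [mul_right_comm, spin_mul_bond h]

/-- Erase the bonds of `F` one at a time. By monotonicity in the couplings, each susceptibility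
produced at an opposite end is still at most `M`. -/
lemma susc_le_removeBonds (ht : ∀ e, t e ∈ Set.Icc (0 : ℝ) 1) {i : ι} {M : ℝ}
    (hM : ∀ j, susc u v t j ≤ M) (F : Finset E) (hF : ∀ e ∈ F, Touches u v e i) :
    susc u v t i ≤ susc u v (removeBonds F t) i + (∑ e ∈ F, t e) * M := by
  induction F using Finset.induction_on with
  | empty => simp [removeBonds]
  | insert e F he ih =>
    have h1 := ih fun e' h => hF e' (Finset.mem_insert_of_mem h)
    have h2 := susc_le_erase (removeBonds_mem_Icc ht F) (hF e (Finset.mem_insert_self _ _))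
    have h3 : Function.update (removeBonds F t) e 0 = removeBonds (insert e F) t := by
      rw [removeBonds, removeBonds, Finset.piecewise_insert]; rfl
    have h4 : removeBonds F t e = t e := by simp [removeBonds, he]
    rw [h3, h4] at h2
    have h5 := (susc_mono (u := u) (v := v) (fun e' => (removeBonds_mem_Icc ht (insert e F) e').1)
      (removeBonds_le (fun e => (ht e).1) (insert e F)) (fun e => (ht e).2)
      (otherEnd u v e i)).trans (hM _)
    rw [Finset.sum_insert he]
    nlinarith [mul_le_mul_of_nonneg_left h5 (ht e).1]

/-- If the strong bonds form a graph in which `i` is a leaf or isolated, and the weak bonds are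
summable, the susceptibility at `i` is bounded in terms of the maximal susceptibility. -/
lemma susc_le_of_leaf (ht : ∀ e, t e ∈ Set.Icc (0 : ℝ) 1) {S : Finset E} {a κ M : ℝ}
    (ha : ∀ e ∈ S, t e ≤ a) (ha0 : 0 ≤ a) (ha1 : a < 1)
    (hS : ∀ i, (S.filter fun e => Touches u v e i).card ≤ 2)
    (hκ : ∀ i, ∑ e ∈ Sᶜ.filter (fun e => Touches u v e i), t e ≤ κ) (hM0 : 0 ≤ M)
    (hM : ∀ j, susc u v t j ≤ M) (n : ℕ) (t' : E → ℝ) (ht' : ∀ e, 0 ≤ t' e)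
    (htt' : ∀ e, t' e ≤ t e) (i : ι) (hn : (S.filter fun e => t' e ≠ 0).card ≤ n)
    (hi : (S.filter fun e => Touches u v e i ∧ t' e ≠ 0).card ≤ 1) :
    susc u v t' i ≤ (1 + κ * M) / (1 - a) := by
  have hκ0 : 0 ≤ κ := (Finset.sum_nonneg fun e _ => (ht e).1).trans (hκ i)
  have hR : 1 + κ * M ≤ (1 + κ * M) / (1 - a) := by
    rw [le_div_iff₀ (by linarith)]; nlinarith [mul_nonneg hκ0 hM0]
  -- The induction is on the number of strong bonds still present. At each step the weak bonds at
  -- `i` are removed at cost `κ * M`, then its only strong bond is crossed and erased.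
  induction n generalizing t' i with
  | zero =>
    have hbd : ∀ e, t' e ∈ Set.Icc (0 : ℝ) 1 := fun e => ⟨ht' e, (htt' e).trans (ht e).2⟩
    have hM' : ∀ j, susc u v t' j ≤ M := fun j =>
      (susc_mono ht' htt' (fun e => (ht e).2) j).trans (hM j)
    have h1 := susc_le_removeBonds hbd (i := i) hM' (Sᶜ.filter (fun e => Touches u v e i)) (by simp)
    rw [susc_eq_one (removeBonds_mem_Icc hbd _)] at h1
    · have h2 := (Finset.sum_le_sum fun e _ => htt' e).trans (hκ i)
      nlinarith [mul_le_mul_of_nonneg_right h2 hM0]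
    · intro e he
      by_cases hes : e ∈ S
      · have : t' e = 0 := by
          by_contra h0
          have : e ∈ S.filter fun e => t' e ≠ 0 := by simp [hes, h0]
          rw [Finset.card_eq_zero.1 (Nat.le_zero.1 hn)] at this
          simp at this
        exact le_antisymm ((removeBonds_le ht' _ e).trans_eq this) (removeBonds_mem_Icc hbd _ e).1
      · simp [removeBonds, hes, he]
  | succ n ih =>
    have hbd : ∀ e, t' e ∈ Set.Icc (0 : ℝ) 1 := fun e => ⟨ht' e, (htt' e).trans (ht e).2⟩
    have hM' : ∀ j, susc u v t' j ≤ M := fun j =>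
      (susc_mono ht' htt' (fun e => (ht e).2) j).trans (hM j)
    set F := Sᶜ.filter (fun e => Touches u v e i) with hF
    have h1 := susc_le_removeBonds hbd (i := i) hM' F (by simp [hF])
    have h2 : (∑ e ∈ F, t' e) ≤ κ := (Finset.sum_le_sum fun e _ => htt' e).trans (hκ i)
    have h3 : susc u v t' i ≤ susc u v (removeBonds F t') i + κ * M :=
      h1.trans (by gcongr)
    rcases Finset.eq_empty_or_nonempty (S.filter fun e => Touches u v e i ∧ t' e ≠ 0) with h | h
    · rw [susc_eq_one (removeBonds_mem_Icc hbd _)] at h3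
      · linarith
      · intro e he
        by_cases hes : e ∈ S
        · have : t' e = 0 := by
            by_contra h0
            have : e ∈ S.filter fun e => Touches u v e i ∧ t' e ≠ 0 := by simp [hes, h0, he]
            rw [h] at this
            simp at this
          exact le_antisymm ((removeBonds_le ht' _ e).trans_eq this)
            (removeBonds_mem_Icc hbd _ e).1
        · simp [removeBonds, hF, hes, he]
    · obtain ⟨e, he⟩ := h
      obtain ⟨heS, hei, het⟩ : e ∈ S ∧ Touches u v e i ∧ t' e ≠ 0 := by simpa using he
      have huniq : ∀ e' ∈ S, Touches u v e' i → t' e' ≠ 0 → e' = e := fun e' h1 h2 h3 =>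
        Finset.card_le_one.1 hi e' (by simp [h1, h2, h3]) e he
      set t'' := Function.update (removeBonds F t') e 0 with ht''
      have hbd'' : ∀ e, t'' e ∈ Set.Icc (0 : ℝ) 1 :=
        update_mem_Icc (removeBonds_mem_Icc hbd F) (Set.left_mem_Icc.2 zero_le_one) e
      have hle'' : ∀ e', t'' e' ≤ t' e' := by
        intro e'
        by_cases h : e' = e
        · subst h; simpa [ht''] using ht' e'
        · simpa [ht'', Function.update_of_ne h] using removeBonds_le ht' F e'
      have h4 := susc_le_erase (removeBonds_mem_Icc hbd F) hei
      rw [← ht'', susc_eq_one hbd''] at h4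
      · have h5 := ih t'' (fun e => (hbd'' e).1) (fun e => (hle'' e).trans (htt' e))
          (otherEnd u v e i) ?_ ?_
        · have h6 : removeBonds F t' e ≤ a :=
            (removeBonds_le ht' F e).trans ((htt' e).trans (ha e heS))
          have h7 : removeBonds F t' e * susc u v t'' (otherEnd u v e i) ≤
              a * ((1 + κ * M) / (1 - a)) :=
            mul_le_mul h6 h5 (susc_nonneg (fun e => (hbd'' e).1) _) ha0
          -- The bound is the fixed point of `R = 1 + κ M + a R`, so it reproduces itself along the
          -- walk.
          have h8 : 1 + κ * M + a * ((1 + κ * M) / (1 - a)) = (1 + κ * M) / (1 - a) := by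
            have : 1 - a ≠ 0 := by linarith
            field_simp; ring
          linarith
        · have : (S.filter fun e => t'' e ≠ 0) ⊂ S.filter fun e => t' e ≠ 0 := by
            rw [Finset.ssubset_iff_of_subset]
            · exact ⟨e, by simp [heS, het], by simp [ht'']⟩
            · intro e' he'
              simp only [Finset.mem_filter] at he' ⊢
              refine ⟨he'.1, fun h0 => he'.2 (le_antisymm ((hle'' e').trans_eq h0) (hbd'' e').1)⟩
          have := Finset.card_lt_card this
          omega
        -- Every site has at most two strong bonds and `e` was one of those at the other end, so at
        -- most one survives there.
        · have : (S.filter fun e' => Touches u v e' (otherEnd u v e i) ∧ t'' e' ≠ 0) ⊂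
              S.filter fun e' => Touches u v e' (otherEnd u v e i) := by
            rw [Finset.ssubset_iff_of_subset]
            · exact ⟨e, by simp [heS, touches_otherEnd], by simp [ht'']⟩
            · intro e' he'
              simp only [Finset.mem_filter] at he' ⊢
              exact ⟨he'.1, he'.2.1⟩
          have := Finset.card_lt_card this
          have := hS (otherEnd u v e i)
          omega
      · intro e' he'
        by_cases h : e' = e
        · simp [ht'', h]
        · rw [ht'', Function.update_of_ne h]
          by_cases hes : e' ∈ S
          · have : t' e' = 0 := by
              by_contra h0
              exact h (huniq e' hes he' h0)
            exact le_antisymm ((removeBonds_le ht' _ e').trans_eq this)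
              (removeBonds_mem_Icc hbd _ e').1
          · simp [removeBonds, hF, hes, he']

/-- High-temperature bound on the susceptibility. -/
theorem susc_le (ht : ∀ e, t e ∈ Set.Icc (0 : ℝ) 1) {S : Finset E} {a κ : ℝ}
    (ha : ∀ e ∈ S, t e ≤ a) (ha0 : 0 ≤ a) (ha1 : a < 1)
    (hS : ∀ i, (S.filter fun e => Touches u v e i).card ≤ 2)
    (hκ : ∀ i, ∑ e ∈ Sᶜ.filter (fun e => Touches u v e i), t e ≤ κ) (hκa : 4 * κ ≤ 1 - a)
    (i : ι) : susc u v t i ≤ 4 / (1 - a) := by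
  obtain ⟨m, -, hm⟩ := Finset.exists_max_image Finset.univ (susc u v t) ⟨i, Finset.mem_univ i⟩
  have hm' : ∀ j, susc u v t j ≤ susc u v t m := fun j => hm j (Finset.mem_univ j)
  refine (hm' i).trans ?_
  set M := susc u v t m
  have hM0 : 0 ≤ M := susc_nonneg (fun e => (ht e).1) m
  have hκ0 : 0 ≤ κ := (Finset.sum_nonneg fun e _ => (ht e).1).trans (hκ i)
  have hleaf := susc_le_of_leaf ht ha ha0 ha1 hS hκ hM0 hm' S.card
  have hR : 0 ≤ (1 + κ * M) / (1 - a) :=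
    div_nonneg (by positivity) (by linarith)
  -- Cutting one strong bond at the maximizing site `m` leaves both of its ends with at most one
  -- strong bond. Each then contributes at most the one-sided bound, the coupling of the cut bond
  -- being at most 1.
  have key : M ≤ 2 * ((1 + κ * M) / (1 - a)) := by
    rcases Finset.eq_empty_or_nonempty (S.filter fun e => Touches u v e m) with h | ⟨e, he⟩
    · have := hleaf t (fun e => (ht e).1) (fun e => le_rfl) m (Finset.card_filter_le _ _) (by
        rw [Finset.filter_and, h]; simp)
      linarith
    · obtain ⟨heS, hem⟩ : e ∈ S ∧ Touches u v e m := by simpa using he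
      set t' := Function.update t e 0 with ht'
      have hbd : ∀ e, t' e ∈ Set.Icc (0 : ℝ) 1 :=
        update_mem_Icc ht (Set.left_mem_Icc.2 zero_le_one) e
      have hle : ∀ e', t' e' ≤ t e' := by
        intro e'
        by_cases h : e' = e
        · subst h; simpa [ht'] using (ht e').1
        · simp [ht', Function.update_of_ne h]
      have hcard : ∀ j, Touches u v e j →
          (S.filter fun e' => Touches u v e' j ∧ t' e' ≠ 0).card ≤ 1 := by
        intro j hj
        have : (S.filter fun e' => Touches u v e' j ∧ t' e' ≠ 0) ⊂
              S.filter fun e' => Touches u v e' j := by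
          rw [Finset.ssubset_iff_of_subset]
          · exact ⟨e, by simp [heS, hj], by simp [ht']⟩
          · intro e' he'
            simp only [Finset.mem_filter] at he' ⊢
            exact ⟨he'.1, he'.2.1⟩
        have := Finset.card_lt_card this
        have := hS j
        omega
      have h1 := hleaf t' (fun e => (hbd e).1) hle m (Finset.card_filter_le _ _) (hcard m hem)
      have h2 := hleaf t' (fun e => (hbd e).1) hle (otherEnd u v e m) (Finset.card_filter_le _ _)
        (hcard _ (touches_otherEnd e m))
      have h3 := susc_le_erase ht hem
      rw [← ht'] at h3
      have h4 := mul_le_mul (ht e).2 h2 (susc_nonneg (fun e => (hbd e).1) _) zero_le_one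
      linarith
  have ha1' : 0 < 1 - a := by linarith
  rw [← mul_div_assoc, le_div_iff₀ ha1'] at key
  rw [le_div_iff₀ ha1']
  -- `(1 - a) M ≤ 2 + 2 κ M ≤ 2 + (1 - a) M / 2`, by `4 κ ≤ 1 - a`.
  nlinarith [mul_le_mul_of_nonneg_right hκa hM0]

end Ising

/-! ### The Ising chain with an additional ferromagnetic pair interaction. -/

section Chain

lemma tanh_le_two_mul {x : ℝ} (hx : 0 ≤ x) : Real.tanh x ≤ 2 * x := by
  rw [Real.tanh_eq_sinh_div_cosh, div_le_iff₀ (Real.cosh_pos x), Real.sinh_eq, Real.cosh_eq]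
  have h1 : Real.exp (-x) = Real.exp x * Real.exp (-2 * x) := by rw [← Real.exp_add]; ring_nf
  have h2 := Real.add_one_le_exp (-2 * x)
  nlinarith [mul_nonneg hx (Real.exp_pos (-x)).le,
    mul_le_mul_of_nonneg_left h2 (Real.exp_pos x).le]

lemma tanh_mem_Icc {x : ℝ} (hx : 0 ≤ x) : Real.tanh x ∈ Set.Icc (0 : ℝ) 1 := by
  rw [Real.tanh_eq_sinh_div_cosh]
  exact ⟨div_nonneg (Real.sinh_nonneg_iff.2 hx) (Real.cosh_pos x).le,
    (div_le_one (Real.cosh_pos x)).2 (Real.sinh_lt_cosh x).le⟩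

/-- This high-temperature identity turns exponential pair weights into bond factors `1 + t * χ`. -/
lemma exp_mul_sign (k : ℝ) {s : ℝ} (hs : s * s = 1) :
    Real.exp (k * s) = Real.cosh k * (1 + Real.tanh k * s) := by
  rw [Real.tanh_eq_sinh_div_cosh]
  have h := (Real.cosh_pos k).ne'
  rcases mul_self_eq_one_iff.1 hs with rfl | rfl
  · field_simp; rw [Real.cosh_add_sinh]
  · field_simp; rw [← sub_eq_add_neg, Real.cosh_sub_sinh]

variable {n : ℕ}

/-- The weight of the Ising chain with nearest neighbour coupling `a` and additional pair
interaction `K`. -/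
noncomputable def chainWeight (a : ℝ) (K : Fin (n + 1) → Fin (n + 1) → ℝ)
    (σ : Fin (n + 1) → ℤˣ) : ℝ :=
  (∏ i : Fin n, (1 + a * (spin i.castSucc σ * spin i.succ σ))) *
    Real.exp (∑ x, ∑ y, K x y * (spin x σ * spin y σ))

/-- First ends of the bonds of the chain. -/
def chainLeft : Fin n ⊕ (Fin (n + 1) × Fin (n + 1)) → Fin (n + 1) :=
  Sum.elim Fin.castSucc Prod.fst

/-- Second ends of the bonds of the chain. -/
def chainRight : Fin n ⊕ (Fin (n + 1) × Fin (n + 1)) → Fin (n + 1) :=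
  Sum.elim Fin.succ Prod.snd

/-- The strengths of the bonds of the chain. -/
noncomputable def chainCoupling (a : ℝ) (K : Fin (n + 1) → Fin (n + 1) → ℝ) :
    Fin n ⊕ (Fin (n + 1) × Fin (n + 1)) → ℝ :=
  Sum.elim (fun _ => a) (fun p => Real.tanh (K p.1 p.2))

lemma chainWeight_eq (a : ℝ) (K : Fin (n + 1) → Fin (n + 1) → ℝ) (σ : Fin (n + 1) → ℤˣ) :
    chainWeight a K σ = (∏ p : Fin (n + 1) × Fin (n + 1), Real.cosh (K p.1 p.2)) *
      weight (bond chainLeft chainRight) (chainCoupling a K) σ := by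
  rw [chainWeight, weight, Fintype.prod_sum_type, mul_left_comm]
  congr 1
  rw [← Finset.prod_mul_distrib, ← Fintype.sum_prod_type', Real.exp_sum]
  refine Finset.prod_congr rfl fun p _ => ?_
  refine exp_mul_sign _ ?_
  rw [mul_mul_mul_comm, hom_sq_eq_one sign_config_sq, hom_sq_eq_one sign_config_sq, one_mul]

lemma sum_sq_chainWeight_le {a : ℝ} (ha0 : 0 ≤ a) (ha1 : a < 1)
    {K : Fin (n + 1) → Fin (n + 1) → ℝ} (hK : ∀ x y, 0 ≤ K x y) {κ : ℝ}
    (hκ : ∀ x, ∑ y, K x y + ∑ y, K y x ≤ κ) (hκa : 8 * κ ≤ 1 - a) :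
    ∑ σ, (∑ x, spin x σ) ^ 2 * chainWeight a K σ ≤
      ((n + 1 : ℕ) : ℝ) * (4 / (1 - a)) * ∑ σ, chainWeight a K σ := by
  classical
  set E := Fin n ⊕ (Fin (n + 1) × Fin (n + 1))
  set χ := bond (chainLeft (n := n)) chainRight
  set t := chainCoupling a K with ht
  have htI : ∀ e : E, t e ∈ Set.Icc (0 : ℝ) 1 := by
    rintro (e | e)
    · exact ⟨ha0, ha1.le⟩
    · exact tanh_mem_Icc (hK _ _)
  set S : Finset E := Finset.univ.filter fun e => e.isLeft = true with hS
  have hsus : ∀ i, susc chainLeft chainRight t i ≤ 4 / (1 - a) := by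
    -- The strong bonds are the nearest-neighbour ones. The doubled `κ` pays for the crude `tanh x ≤
    -- 2 x`, which is why `8 * κ ≤ 1 - a` is assumed.
    refine susc_le (κ := 2 * κ) htI (S := S) ?_ ha0 ha1 ?_ ?_ (by linarith)
    · rintro (e | e) he
      · exact le_rfl
      · simp [hS] at he
    · intro i
      have hsub : (S.filter fun e => Touches chainLeft chainRight e i) ⊆
          (Finset.univ.filter fun j : Fin n => j.castSucc = i).map .inl ∪
          (Finset.univ.filter fun j : Fin n => j.succ = i).map .inl := by
        rintro (e | e) he
        · simpa [hS, Touches, chainLeft, chainRight] using he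
        · simp [hS] at he
      refine (Finset.card_le_card hsub).trans ((Finset.card_union_le _ _).trans ?_)
      rw [Finset.card_map, Finset.card_map]
      refine add_le_add (Finset.card_le_one.2 ?_) (Finset.card_le_one.2 ?_)
      · intro x hx y hy
        simp only [Finset.mem_filter, Finset.mem_univ, true_and] at hx hy
        exact Fin.castSucc_injective _ (hx.trans hy.symm)
      · intro x hx y hy
        simp only [Finset.mem_filter, Finset.mem_univ, true_and] at hx hy
        exact Fin.succ_injective _ (hx.trans hy.symm)
    · intro i
      have h1 : ∑ e ∈ Sᶜ.filter (fun e => Touches chainLeft chainRight e i), t e =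
          ∑ p : Fin (n + 1) × Fin (n + 1),
            if p.1 = i ∨ p.2 = i then Real.tanh (K p.1 p.2) else 0 := by
        have : Sᶜ.filter (fun e => Touches chainLeft chainRight e i) =
            Finset.univ.filter (fun e => e.isLeft = false ∧ Touches chainLeft chainRight e i) := by
          ext e; simp [hS]
        rw [this, Finset.sum_filter, Fintype.sum_sum_type]
        simp [Touches, chainLeft, chainRight, ht, chainCoupling]
      rw [h1, Fintype.sum_prod_type]
      have h2 : ∀ x y, (if x = i ∨ y = i then Real.tanh (K x y) else 0) ≤
          (if x = i then 2 * K x y else 0) + (if y = i then 2 * K x y else 0) := by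
        intro x y
        have h3 := tanh_le_two_mul (hK x y)
        have h4 := hK x y
        by_cases hx : x = i <;> by_cases hy : y = i <;> simp [hx, hy] <;> subst_vars <;> linarith
      refine (Finset.sum_le_sum fun x _ => Finset.sum_le_sum fun y _ => h2 x y).trans ?_
      simp only [Finset.sum_add_distrib, Finset.sum_ite_eq', Finset.mem_univ, if_true]
      have h5 : ∀ x, (∑ y, if x = i then 2 * K x y else 0) =
          if x = i then ∑ y, 2 * K x y else 0 := by
        intro x; split_ifs <;> simp
      simp only [h5, Finset.sum_ite_eq', Finset.mem_univ, if_true, ← Finset.mul_sum]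
      linarith [hκ i]
  set c := ∏ p : Fin (n + 1) × Fin (n + 1), Real.cosh (K p.1 p.2)
  have hc : 0 ≤ c := Finset.prod_nonneg fun p _ => (Real.cosh_pos _).le
  have hZ : 0 < num χ 1 t :=
    num_one_pos sign_config_sq (fun e => (htI e).1) (fun e => (htI e).2)
  have h1 : ∑ σ, chainWeight a K σ = c * num χ 1 t := by
    simp only [chainWeight_eq, num, MonoidHom.one_apply, one_mul, ← Finset.mul_sum]
    rfl
  have h2 : ∑ σ, (∑ x, spin x σ) ^ 2 * chainWeight a K σ =
      c * ∑ x, num χ 1 t * susc chainLeft chainRight t x := by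
    have h3 : ∀ x, num χ 1 t * susc chainLeft chainRight t x =
        ∑ s, num χ (spin x * spin s) t := by
      intro x
      rw [susc, Finset.mul_sum]
      exact Finset.sum_congr rfl fun s _ => mul_div_cancel₀ _ hZ.ne'
    have h4 : ∀ σ : Fin (n + 1) → ℤˣ, (∑ x, spin x σ) ^ 2 * chainWeight a K σ =
        ∑ x, ∑ s, c * ((spin x * spin s : (Fin (n + 1) → ℤˣ) →* ℝ) σ * weight χ t σ) := by
      intro σ
      rw [sq, Finset.sum_mul_sum, chainWeight_eq]
      simp only [Finset.sum_mul, MonoidHom.mul_apply]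
      refine Finset.sum_congr rfl fun x _ => Finset.sum_congr rfl fun s _ => by ring
    rw [Finset.sum_congr rfl fun σ _ => h4 σ, Finset.sum_congr rfl fun x _ => h3 x,
      Finset.sum_comm, Finset.mul_sum]
    refine Finset.sum_congr rfl fun x _ => ?_
    rw [Finset.sum_comm, Finset.mul_sum]
    refine Finset.sum_congr rfl fun s _ => ?_
    rw [num, Finset.mul_sum]
  rw [h1, h2]
  calc c * ∑ x, num χ 1 t * susc chainLeft chainRight t x
      ≤ c * ∑ _x : Fin (n + 1), num χ 1 t * (4 / (1 - a)) := by
        gcongr with x; exact hsus x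
    _ = _ := by simp; ring

end Chain

/-! ### The law of the jump process on a grid. -/

section Law

variable {Ω : Type*} [MeasurableSpace Ω] {P : Measure Ω} [IsProbabilityMeasure P]
  {N : ℝ → Ω → ℤ} {B : Ω → ℝ}

/-- The random sign `B`, as a unit of `ℤ`. -/
noncomputable def unitSign (B : Ω → ℝ) (ω : Ω) : ℤˣ := if B ω = 1 then 1 else -1

/-- The jump process, with values in the units of `ℤ`. -/
noncomputable def unitProcess (N : ℝ → Ω → ℤ) (B : Ω → ℝ) (t : ℝ) (ω : Ω) : ℤˣ :=
  unitSign B ω * (N t ω).negOnePow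

lemma IsRandomSign.ae_eq (hB : IsRandomSign B P) : ∀ᵐ ω ∂P, B ω = 1 ∨ B ω = -1 := by
  have hm1 : MeasurableSet {ω | B ω = 1} := hB.measurable (measurableSet_singleton 1)
  have hm2 : MeasurableSet {ω | B ω = -1} := hB.measurable (measurableSet_singleton (-1))
  have h : P ({ω | B ω = 1} ∪ {ω | B ω = -1}) = 1 := by
    rw [measure_union _ hm2, hB.prob_one, hB.prob_neg_one, ENNReal.add_halves]
    rw [Set.disjoint_left]
    intro ω h1 h2
    simp only [Set.mem_ofPred_eq] at h1 h2
    linarith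
  have h2 := (prob_compl_eq_zero_iff (hm1.union hm2)).2 h
  rw [ae_iff]
  convert h2 using 2
  ext ω; simp

lemma IsRandomSign.ae_jumpProcess_eq (hB : IsRandomSign B P) :
    ∀ᵐ ω ∂P, ∀ t, jumpProcess N B t ω = ((unitProcess N B t ω : ℤ) : ℝ) := by
  filter_upwards [hB.ae_eq] with ω hω t
  have h : ((unitSign B ω : ℤ) : ℝ) = B ω := by
    rcases hω with h | h
    · simp [unitSign, h]
    · rw [unitSign, if_neg (by rw [h]; norm_num), h]; simp
  rw [unitProcess, jumpProcess, ← h, Units.val_mul, Int.cast_mul, Int.negOnePow_def]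
  congr 1
  rcases Int.even_or_odd (N t ω) with h | h
  · rw [h.neg_one_zpow, ← Int.negOnePow_def, Int.negOnePow_even _ h]; simp
  · rw [h.neg_one_zpow, ← Int.negOnePow_def, Int.negOnePow_odd _ h]; simp

/-- `unitSign` sends every value other than 1 to `-1`, so the event for `-1` is the complement of `B
= 1`, again of probability one half. -/
lemma IsRandomSign.measurable_unitSign_eq (hB : IsRandomSign B P) (s : ℤˣ) :
    ∃ S : Set ℝ, MeasurableSet S ∧ {ω | unitSign B ω = s} = B ⁻¹' S ∧ P (B ⁻¹' S) = 1 / 2 := by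
  rcases Int.units_eq_one_or s with rfl | rfl
  · refine ⟨{1}, measurableSet_singleton 1, ?_, hB.prob_one⟩
    ext ω
    by_cases h : B ω = 1 <;> simp [unitSign, h]
  · refine ⟨{1}ᶜ, (measurableSet_singleton 1).compl, ?_, ?_⟩
    · ext ω
      by_cases h : B ω = 1 <;> simp [unitSign, h]
    · rw [Set.preimage_compl, prob_compl_eq_one_sub (hB.measurable (measurableSet_singleton 1))]
      have : P (B ⁻¹' {1}) = 1 / 2 := hB.prob_one
      rw [this]; simp

lemma negOnePow_sub_eq_iff (k l : ℤ) (s : ℤˣ) :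
    (k - l).negOnePow = s ↔ k.negOnePow = l.negOnePow * s := by
  rw [Int.negOnePow_sub]
  constructor
  · rintro rfl
    rw [mul_left_comm, Int.units_mul_self, mul_one]
  · intro h
    rw [h, mul_right_comm, Int.units_mul_self, one_mul]

lemma IsTwoSidedPoisson.prob_increment_sign (hN : IsTwoSidedPoisson N P) {s t : ℝ} (hst : s ≤ t)
    (z : ℤˣ) : P {ω | (N t ω - N s ω).negOnePow = z} =
      ENNReal.ofReal ((1 + Real.exp (-2 * (t - s)) * ((z : ℤ) : ℝ)) / 2) := by
  have hm : MeasurableSet {ω | (N t ω - N s ω).negOnePow = z} :=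
    ((hN.measurable t).sub (hN.measurable s))
      (.of_discrete : MeasurableSet {k : ℤ | k.negOnePow = z})
  rw [← ofReal_measureReal]
  congr 1
  -- `f` is the indicator of parity sign `z`, written as `(1 + sign * z) / 2`. Its Poisson mean
  -- follows from `E[(-1)^K] = exp (-2r)` for `K` of mean `r`.
  set f : ℤ → ℝ := fun k => (1 + ((k.negOnePow : ℤ) : ℝ) * ((z : ℤ) : ℝ)) / 2 with hf
  have h1 : P.real {ω | (N t ω - N s ω).negOnePow = z} =
      ∫ ω, (f ∘ fun ω => N t ω - N s ω) ω ∂P := by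
    rw [← integral_indicator_one hm]
    congr 1
    funext ω
    simp only [Set.indicator, Set.mem_ofPred_eq, Function.comp, hf, Pi.one_apply]
    rcases Int.units_eq_one_or (N t ω - N s ω).negOnePow with h | h <;>
      rcases Int.units_eq_one_or z with h' | h' <;> rw [h, h'] <;> norm_num
  have hr : ((t - s).toNNReal : ℝ) = t - s := Real.coe_toNNReal _ (sub_nonneg.2 hst)
  rw [h1, (hN.law_increment s t hst).integral_comp .of_discrete, integral_map_cast_poissonMeasure,
    hr]
  refine HasSum.tsum_eq ?_
  have h2 : ∀ x : ℝ, HasSum (fun n : ℕ => x ^ n / (n.factorial : ℝ)) (Real.exp x) := fun x => by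
    rw [Real.exp_eq_exp_ℝ]; exact NormedSpace.expSeries_div_hasSum_exp x
  have h3 := (((h2 (t - s)).add ((h2 (-(t - s))).mul_right ((z : ℤ) : ℝ))).mul_left
    (Real.exp (-(t - s)))).div_const 2
  have h4 : Real.exp (-(t - s)) * Real.exp (t - s) = 1 := by
    rw [← Real.exp_add]; simp
  have h5 : Real.exp (-(t - s)) * Real.exp (-(t - s)) = Real.exp (-2 * (t - s)) := by
    rw [← Real.exp_add]; ring_nf
  rw [mul_add, h4, ← mul_assoc, h5] at h3
  refine h3.congr_fun ?_
  · intro n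
    simp only [hf, smul_eq_mul]
    have : (((n : ℤ).negOnePow : ℤ) : ℝ) = (-1) ^ n := by
      rw [Int.coe_negOnePow_natCast]; push_cast; rfl
    rw [this, neg_pow (t - s)]
    ring

/-- The joint law of the signs of the jump process on a grid is that of an Ising chain. -/
lemma IsTwoSidedPoisson.prob_unitProcess (hN : IsTwoSidedPoisson N P) (hB : IsRandomSign B P)
    (hI : IndepFun B (fun ω t => N t ω) P) {n : ℕ} {τ : Fin (n + 1) → ℝ} {δ : ℝ} (hδ : 0 ≤ δ)
    (hτ : ∀ i : Fin n, τ i.succ - τ i.castSucc = δ) (σ : Fin (n + 1) → ℤˣ) :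
    P.real {ω | ∀ i, unitProcess N B (τ i) ω = σ i} =
      1 / 2 * ∏ i : Fin n,
        ((1 + Real.exp (-2 * δ) * (spin i.castSucc σ * spin i.succ σ)) / 2) := by
  have hmono : Monotone τ := Fin.monotone_iff_le_succ.2 fun i => by linarith [hτ i]
  set D : Set (ℝ → ℤ) := {x | ∀ i : Fin n,
    (x (τ i.succ) - x (τ i.castSucc)).negOnePow = σ i.castSucc * σ i.succ} with hD
  have hDm : MeasurableSet D := by
    rw [hD, Set.ofPred_forall]
    refine MeasurableSet.iInter fun i => ?_
    have hm : Measurable fun x : ℝ → ℤ => x (τ i.succ) - x (τ i.castSucc) :=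
      (measurable_pi_apply _).sub (measurable_pi_apply _)
    exact hm (.of_discrete : MeasurableSet {k : ℤ | k.negOnePow = σ i.castSucc * σ i.succ})
  set A : ℤˣ → Set (ℝ → ℤ) := fun s => {x | (x (τ 0)).negOnePow = s} with hA
  have hAm : ∀ s, MeasurableSet (A s) := fun s => by
    have hm : Measurable fun x : ℝ → ℤ => x (τ 0) := measurable_pi_apply _
    exact hm (.of_discrete : MeasurableSet {k : ℤ | k.negOnePow = s})
  set F : Ω → ℝ → ℤ := fun ω t => N t ω with hF
  have hFm : Measurable F := measurable_pi_lambda _ hN.measurable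
  have hevent : ∀ ω, (∀ i, unitProcess N B (τ i) ω = σ i) ↔
      unitProcess N B (τ 0) ω = σ 0 ∧ F ω ∈ D := by
    intro ω
    have hstep : ∀ i : Fin n, unitProcess N B (τ i.succ) ω =
        unitProcess N B (τ i.castSucc) ω *
          (N (τ i.succ) ω - N (τ i.castSucc) ω).negOnePow := by
      intro i
      rw [unitProcess, unitProcess, mul_assoc]
      congr 1
      exact (negOnePow_sub_eq_iff _ _ _).1 rfl
    constructor
    · refine fun h => ⟨h 0, fun i => ?_⟩
      have := hstep i
      rw [h, h] at this
      simp only [hF]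
      rw [this, ← mul_assoc, Int.units_mul_self, one_mul]
    · rintro ⟨h0, h⟩ i
      induction i using Fin.induction with
      | zero => exact h0
      | succ i ih =>
        rw [hstep, ih, show (N (τ i.succ) ω - N (τ i.castSucc) ω).negOnePow = _ from h i,
          ← mul_assoc, Int.units_mul_self, one_mul]
  have hprobD : P (F ⁻¹' D) = ∏ i : Fin n, ENNReal.ofReal
      ((1 + Real.exp (-2 * δ) * (spin i.castSucc σ * spin i.succ σ)) / 2) := by
    have h1 := (hN.indep_increments n τ hmono).measure_inter_preimage_eq_mul Finset.univ
      (sets := fun i => {k : ℤ | k.negOnePow = σ i.castSucc * σ i.succ})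
      (fun _ _ => MeasurableSet.of_discrete)
    have h2 : F ⁻¹' D = ⋂ i ∈ (Finset.univ : Finset (Fin n)),
        (fun ω => N (τ i.succ) ω - N (τ i.castSucc) ω) ⁻¹'
          {k : ℤ | k.negOnePow = σ i.castSucc * σ i.succ} := by
      ext ω; simp [hD, hF]
    rw [h2, h1]
    refine Finset.prod_congr rfl fun i _ => ?_
    have h3 := hN.prob_increment_sign (hmono (Fin.castSucc_le_succ i)) (σ i.castSucc * σ i.succ)
    rw [hτ] at h3
    refine h3.trans ?_
    rw [spin_apply, spin_apply, Units.val_mul, Int.cast_mul]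
  -- Split by the parity of `N (τ 0)`. Since `B` is independent of the whole path and uniform, each
  -- part contributes a factor one half; no independence of `N (τ 0)` from the later increments is
  -- needed.
  have hsplit : {ω | ∀ i, unitProcess N B (τ i) ω = σ i} =
      ({ω | unitSign B ω = σ 0 * 1} ∩ F ⁻¹' (A 1 ∩ D)) ∪
        ({ω | unitSign B ω = σ 0 * -1} ∩ F ⁻¹' (A (-1) ∩ D)) := by
    ext ω
    rw [Set.mem_ofPred_eq, hevent, unitProcess]
    simp only [Set.mem_ofPred_eq, Set.mem_union, Set.mem_inter_iff, Set.mem_preimage, hA, hF]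
    rcases Int.units_eq_one_or (N (τ 0) ω).negOnePow with h | h <;> rw [h]
    · simp
    · simp [neg_eq_iff_eq_neg]
  have hdisjA : Disjoint (A 1) (A (-1)) := by
    rw [Set.disjoint_left]
    intro x h1 h2
    simp only [hA, Set.mem_ofPred_eq] at h1 h2
    rw [h1] at h2
    exact absurd h2 (by decide)
  have hunion : F ⁻¹' D = F ⁻¹' (A 1 ∩ D) ∪ F ⁻¹' (A (-1) ∩ D) := by
    ext ω
    simp only [Set.mem_union, Set.mem_preimage, Set.mem_inter_iff, hA, Set.mem_ofPred_eq]
    rcases Int.units_eq_one_or (F ω (τ 0)).negOnePow with h | h <;> simp [h]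
  have hpart : ∀ s z : ℤˣ, MeasurableSet ({ω | unitSign B ω = z} ∩ F ⁻¹' (A s ∩ D)) ∧
      P ({ω | unitSign B ω = z} ∩ F ⁻¹' (A s ∩ D)) = 1 / 2 * P (F ⁻¹' (A s ∩ D)) := by
    intro s z
    obtain ⟨S, hS, hSe, hSp⟩ := hB.measurable_unitSign_eq z
    have hm := (hAm s).inter hDm
    rw [hSe]
    exact ⟨(hB.measurable hS).inter (hFm hm),
      by rw [hI.measure_inter_preimage_eq_mul S _ hS hm, hSp]⟩
  have htotal : P {ω | ∀ i, unitProcess N B (τ i) ω = σ i} = 1 / 2 * P (F ⁻¹' D) := by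
    rw [hsplit, measure_union _ (hpart _ _).1, (hpart _ _).2, (hpart _ _).2, ← mul_add, hunion,
      measure_union _ (hFm ((hAm _).inter hDm))]
    · exact (hdisjA.mono Set.inter_subset_left Set.inter_subset_left).preimage F
    · exact ((hdisjA.mono Set.inter_subset_left Set.inter_subset_left).preimage F).mono
        Set.inter_subset_right Set.inter_subset_right
  rw [measureReal_def, htotal, hprobD, ENNReal.toReal_mul, ENNReal.toReal_prod]
  congr 1
  · simp
  · refine Finset.prod_congr rfl fun i _ => ENNReal.toReal_ofReal ?_
    have h1 : Real.exp (-2 * δ) ≤ 1 := Real.exp_le_one_iff.2 (by linarith)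
    have h2 : -1 ≤ spin i.castSucc σ * spin i.succ σ := by
      rw [← MonoidHom.mul_apply]; exact neg_one_le_hom sign_config_sq _ _
    nlinarith [Real.exp_pos (-2 * δ)]

lemma measurableSet_unitProcess (hN : IsTwoSidedPoisson N P) (hB : IsRandomSign B P) {n : ℕ}
    (τ : Fin n → ℝ) (σ : Fin n → ℤˣ) :
    MeasurableSet {ω | ∀ i, unitProcess N B (τ i) ω = σ i} := by
  rw [Set.ofPred_forall]
  refine MeasurableSet.iInter fun i => ?_
  have h : {ω | unitProcess N B (τ i) ω = σ i} =
      ⋃ z : ℤˣ, {ω | unitSign B ω = z} ∩ N (τ i) ⁻¹' {k | k.negOnePow = z * σ i} := by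
    ext ω
    simp only [unitProcess, Set.mem_ofPred_eq, Set.mem_iUnion, Set.mem_inter_iff, Set.mem_preimage,
      exists_eq_left']
    constructor
    · intro h; rw [← h, ← mul_assoc, Int.units_mul_self, one_mul]
    · intro h; rw [h, ← mul_assoc, Int.units_mul_self, one_mul]
  rw [h]
  refine MeasurableSet.iUnion fun z => ?_
  obtain ⟨S, hS, hSe, -⟩ := hB.measurable_unitSign_eq z
  rw [hSe]
  exact (hB.measurable hS).inter (hN.measurable _ .of_discrete)

lemma eq_sum_indicator {Ω : Type*} {N : ℝ → Ω → ℤ} {B : Ω → ℝ} {n : ℕ} (τ : Fin n → ℝ) (f : (Fin n → ℤˣ) → ℝ) (ω : Ω) :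
    f (fun i => unitProcess N B (τ i) ω) =
      ∑ σ, {ω | ∀ i, unitProcess N B (τ i) ω = σ i}.indicator (fun _ => f σ) ω := by
  rw [Finset.sum_eq_single (fun i => unitProcess N B (τ i) ω)]
  · simp [Set.indicator]
  · intro σ _ hσ
    refine Set.indicator_of_notMem (fun h => hσ ?_) _
    funext i; exact (h i).symm
  · simp

lemma measurable_comp_unitProcess (hN : IsTwoSidedPoisson N P) (hB : IsRandomSign B P) {n : ℕ}
    (τ : Fin n → ℝ) (f : (Fin n → ℤˣ) → ℝ) :
    Measurable (fun ω => f (fun i => unitProcess N B (τ i) ω)) := by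
  simp only [eq_sum_indicator τ f]
  exact Finset.measurable_sum _ fun σ _ =>
    measurable_const.indicator (measurableSet_unitProcess hN hB τ σ)

lemma integral_comp_unitProcess (hN : IsTwoSidedPoisson N P) (hB : IsRandomSign B P)
    (hI : IndepFun B (fun ω t => N t ω) P) {n : ℕ} {τ : Fin (n + 1) → ℝ} {δ : ℝ} (hδ : 0 ≤ δ)
    (hτ : ∀ i : Fin n, τ i.succ - τ i.castSucc = δ) (f : (Fin (n + 1) → ℤˣ) → ℝ) :
    ∫ ω, f (fun i => unitProcess N B (τ i) ω) ∂P = (1 / 2) ^ (n + 1) *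
      ∑ σ, f σ * ∏ i : Fin n,
        (1 + Real.exp (-2 * δ) * (spin i.castSucc σ * spin i.succ σ)) := by
  simp only [eq_sum_indicator τ f]
  rw [integral_finsetSum _ fun σ _ =>
    (integrable_const _).indicator (measurableSet_unitProcess hN hB τ σ), Finset.mul_sum]
  refine Finset.sum_congr rfl fun σ _ => ?_
  rw [integral_indicator_const _ (measurableSet_unitProcess hN hB τ σ),
    hN.prob_unitProcess hB hI hδ hτ, smul_eq_mul, Finset.prod_div_distrib]
  simp only [Finset.prod_const, Finset.card_univ, Fintype.card_fin]
  rw [div_pow, one_pow, pow_succ]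
  ring

/-- The high-temperature bound for the jump process sampled on a grid. -/
lemma integral_sq_mul_exp_le (hN : IsTwoSidedPoisson N P) (hB : IsRandomSign B P)
    (hI : IndepFun B (fun ω t => N t ω) P) {n : ℕ} {τ : Fin (n + 1) → ℝ} {δ : ℝ} (hδ : 0 < δ)
    (hτ : ∀ i : Fin n, τ i.succ - τ i.castSucc = δ) {K : Fin (n + 1) → Fin (n + 1) → ℝ}
    (hK : ∀ x y, 0 ≤ K x y) {κ : ℝ} (hκ : ∀ x, ∑ y, K x y + ∑ y, K y x ≤ κ)
    (hκa : 8 * κ ≤ 1 - Real.exp (-2 * δ)) :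
    ∫ ω, (∑ x, ((unitProcess N B (τ x) ω : ℤ) : ℝ)) ^ 2 * Real.exp (∑ x, ∑ y, K x y *
        (((unitProcess N B (τ x) ω : ℤ) : ℝ) * ((unitProcess N B (τ y) ω : ℤ) : ℝ))) ∂P ≤
      ((n + 1 : ℕ) : ℝ) * (4 / (1 - Real.exp (-2 * δ))) * ∫ ω, Real.exp (∑ x, ∑ y, K x y *
        (((unitProcess N B (τ x) ω : ℤ) : ℝ) * ((unitProcess N B (τ y) ω : ℤ) : ℝ))) ∂P := by
  have h1 := integral_comp_unitProcess hN hB hI hδ.le hτ (fun σ => (∑ x, spin x σ) ^ 2 *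
    Real.exp (∑ x, ∑ y, K x y * (spin x σ * spin y σ)))
  have h2 := integral_comp_unitProcess hN hB hI hδ.le hτ (fun σ =>
    Real.exp (∑ x, ∑ y, K x y * (spin x σ * spin y σ)))
  simp only [spin_apply] at h1 h2
  rw [h1, h2, mul_left_comm]
  refine mul_le_mul_of_nonneg_left ?_ (by positivity)
  have h3 := sum_sq_chainWeight_le (Real.exp_pos (-2 * δ)).le
    (Real.exp_lt_one_iff.2 (by linarith)) hK hκ hκa
  refine (le_of_eq ?_).trans (h3.trans_eq ?_)
  · refine Finset.sum_congr rfl fun σ _ => ?_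
    simp only [chainWeight, spin_apply]; ring
  · congr 1
    refine Finset.sum_congr rfl fun σ _ => ?_
    simp only [chainWeight, spin_apply]; ring

end Law

/-! ### Step functions on a grid and the induced couplings. -/

section Discretization

/-- Lebesgue measure on `(-T, T]`. -/
noncomputable def boxMeasure (T : ℝ) : Measure ℝ := volume.restrict (Set.Ioc (-T) T)

instance (T : ℝ) : IsFiniteMeasure (boxMeasure T) := by unfold boxMeasure; infer_instance

/-- The mesh of the partition of `(-T, T]` into `n + 1` cells. -/
noncomputable def mesh (T : ℝ) (n : ℕ) : ℝ := 2 * T / (n + 1)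

/-- The right end of the `i`-th cell. -/
noncomputable def gridPoint (T : ℝ) (n : ℕ) (i : Fin (n + 1)) : ℝ := -T + ((i : ℕ) + 1) * mesh T n

/-- The `i`-th cell of the partition. -/
def cell (T : ℝ) (n : ℕ) (i : Fin (n + 1)) : Set ℝ :=
  Set.Ioc (-T + (i : ℕ) * mesh T n) (gridPoint T n i)

/-- The indicator function of the `i`-th cell. -/
noncomputable def cellInd (T : ℝ) (n : ℕ) (i : Fin (n + 1)) : ℝ → ℝ :=
  (cell T n i).indicator 1

/-- The step function taking on each cell the value of `x` at the right end. -/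
noncomputable def stepFun (T : ℝ) (n : ℕ) (x : ℝ → ℝ) (t : ℝ) : ℝ :=
  ∑ i, x (gridPoint T n i) * cellInd T n i t

variable {T : ℝ} {n : ℕ}

lemma mesh_pos (hT : 0 < T) : 0 < mesh T n := by unfold mesh; positivity

lemma mesh_mul : ((n : ℝ) + 1) * mesh T n = 2 * T := by
  unfold mesh; field_simp

lemma gridPoint_sub (i : Fin n) :
    gridPoint T n i.succ - gridPoint T n i.castSucc = mesh T n := by
  simp [gridPoint]; ring

lemma tendsto_mesh : Tendsto (mesh T) atTop (𝓝 0) := by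
  have := (tendsto_one_div_add_atTop_nhds_zero_nat (𝕜 := ℝ)).const_mul (2 * T)
  rw [mul_zero] at this
  refine this.congr fun n => ?_
  rw [mesh]; ring

lemma measurableSet_cell (i : Fin (n + 1)) : MeasurableSet (cell T n i) := measurableSet_Ioc

lemma measurable_cellInd (i : Fin (n + 1)) : Measurable (cellInd T n i) :=
  measurable_one.indicator (measurableSet_cell i)

lemma cellInd_nonneg (i : Fin (n + 1)) (t : ℝ) : 0 ≤ cellInd T n i t :=
  Set.indicator_nonneg (fun _ _ => zero_le_one) t

lemma cellInd_le_one (i : Fin (n + 1)) (t : ℝ) : cellInd T n i t ≤ 1 :=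
  Set.indicator_le' (fun _ _ => le_rfl) (fun _ _ => zero_le_one) t

lemma cell_subset (hT : 0 < T) (i : Fin (n + 1)) : cell T n i ⊆ Set.Ioc (-T) T := by
  have hm := mesh_pos (n := n) hT
  refine Set.Ioc_subset_Ioc (by nlinarith [(Nat.cast_nonneg (i : ℕ) : (0 : ℝ) ≤ _)]) ?_
  have h1 : ((i : ℕ) : ℝ) + 1 ≤ n + 1 := by exact_mod_cast i.2
  have h2 := mesh_mul (T := T) (n := n)
  rw [gridPoint]
  nlinarith

lemma exists_cell (hT : 0 < T) {t : ℝ} (ht : t ∈ Set.Ioc (-T) T) :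
    ∃ i : Fin (n + 1), t ≤ gridPoint T n i ∧ gridPoint T n i ≤ t + mesh T n ∧
      ∀ j, cellInd T n j t = if j = i then 1 else 0 := by
  have hm := mesh_pos (n := n) hT
  have hmul := mesh_mul (T := T) (n := n)
  -- The cells are open on the left and closed on the right, so the ceiling is the cell number
  -- counted from 1.
  set k := ⌈(t + T) / mesh T n⌉ with hk
  have hkpos : 0 < k := Int.ceil_pos.2 (div_pos (by linarith [ht.1]) hm)
  have hkle : k ≤ n + 1 := by
    refine Int.ceil_le.2 ?_
    rw [div_le_iff₀ hm]; push_cast; linarith [ht.2]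
  have hmem : ∀ j : Fin (n + 1), t ∈ cell T n j ↔ k = (j : ℕ) + 1 := by
    intro j
    rw [hk, Int.ceil_eq_iff, lt_div_iff₀ hm, div_le_iff₀ hm, cell, gridPoint, Set.mem_Ioc]
    push_cast
    constructor <;> rintro ⟨h1, h2⟩ <;> constructor <;> linarith
  obtain ⟨i, hi⟩ : ∃ i : Fin (n + 1), k = (i : ℕ) + 1 :=
    ⟨⟨(k - 1).toNat, by omega⟩, by simp only; omega⟩
  have hti := (hmem i).2 hi
  refine ⟨i, hti.2, ?_, fun j => ?_⟩
  · have := hti.1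
    rw [gridPoint]; linarith
  · by_cases h : j = i
    · subst h
      rw [if_pos rfl, cellInd, Set.indicator_of_mem hti, Pi.one_apply]
    · rw [if_neg h, cellInd, Set.indicator_of_notMem]
      refine fun h' => h (Fin.ext ?_)
      have := (hmem j).1 h'
      omega

lemma sum_cellInd (hT : 0 < T) {t : ℝ} (ht : t ∈ Set.Ioc (-T) T) :
    ∑ i, cellInd T n i t = 1 := by
  obtain ⟨i, -, -, h⟩ := exists_cell (n := n) hT ht
  simp [h]

lemma exists_stepFun_eq (hT : 0 < T) {t : ℝ} (ht : t ∈ Set.Ioc (-T) T) (n : ℕ) (x : ℝ → ℝ) :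
    ∃ r, t ≤ r ∧ r ≤ t + mesh T n ∧ stepFun T n x t = x r := by
  obtain ⟨i, h1, h2, h⟩ := exists_cell (n := n) hT ht
  exact ⟨_, h1, h2, by simp [stepFun, h]⟩

/-- Cells are sampled at their right ends, which approach `t` from the right, so right-continuity
suffices. -/
lemma tendsto_stepFun (hT : 0 < T) {t : ℝ} (ht : t ∈ Set.Ioc (-T) T) {x : ℝ → ℝ}
    (hx : ContinuousWithinAt x (Set.Ici t) t) :
    Tendsto (fun n => stepFun T n x t) atTop (𝓝 (x t)) := by
  choose r h1 h2 h3 using fun n => exists_stepFun_eq hT ht n x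
  simp only [h3]
  refine hx.tendsto.comp (tendsto_nhdsWithin_iff.2 ⟨?_, .of_forall h1⟩)
  refine tendsto_of_tendsto_of_tendsto_of_le_of_le tendsto_const_nhds ?_ h1 h2
  simpa using (tendsto_mesh (T := T)).const_add t

lemma abs_stepFun_le (hT : 0 < T) {t : ℝ} (ht : t ∈ Set.Ioc (-T) T) (n : ℕ) {x : ℝ → ℝ}
    (hx : ∀ t, |x t| ≤ 1) : |stepFun T n x t| ≤ 1 := by
  obtain ⟨r, -, -, h⟩ := exists_stepFun_eq hT ht n x
  rw [h]; exact hx r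

lemma measurable_stepFun (x : ℝ → ℝ) : Measurable (stepFun T n x) :=
  Finset.measurable_sum _ fun i _ => (measurable_cellInd i).const_mul _

lemma ae_boxMeasure : ∀ᵐ t ∂(boxMeasure T), t ∈ Set.Ioc (-T) T :=
  ae_restrict_mem measurableSet_Ioc

lemma ae_boxMeasure_prod : ∀ᵐ p ∂((boxMeasure T).prod (boxMeasure T)),
    p.1 ∈ Set.Ioc (-T) T ∧ p.2 ∈ Set.Ioc (-T) T := by
  have h : (boxMeasure T).prod (boxMeasure T) =
      (volume.prod volume).restrict (Set.Ioc (-T) T ×ˢ Set.Ioc (-T) T) :=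
    Measure.prod_restrict _ _
  rw [h]
  exact ae_restrict_mem (measurableSet_Ioc.prod measurableSet_Ioc)

lemma integral_cellInd (hT : 0 < T) (i : Fin (n + 1)) :
    ∫ t, cellInd T n i t ∂(boxMeasure T) = mesh T n := by
  rw [cellInd, integral_indicator_one (measurableSet_cell i), boxMeasure, measureReal_def,
    Measure.restrict_apply (measurableSet_cell i)]
  rw [Set.inter_eq_left.2 (cell_subset hT i), cell, Real.volume_Ioc, gridPoint,
    ENNReal.toReal_ofReal] <;> linarith [mesh_pos (n := n) hT]

lemma integrable_of_bound {x : ℝ → ℝ} (hx : Measurable x) {c : ℝ} (hc : ∀ t, |x t| ≤ c) :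
    Integrable x (boxMeasure T) :=
  Integrable.of_bound hx.aestronglyMeasurable c (.of_forall hc)

lemma integral_stepFun (hT : 0 < T) (x : ℝ → ℝ) :
    ∫ t, stepFun T n x t ∂(boxMeasure T) = mesh T n * ∑ i, x (gridPoint T n i) := by
  simp only [stepFun]
  rw [integral_finsetSum, Finset.mul_sum]
  · refine Finset.sum_congr rfl fun i _ => ?_
    rw [integral_const_mul, integral_cellInd hT, mul_comm]
  · refine fun i _ => Integrable.const_mul (integrable_of_bound (measurable_cellInd i) (c := 1) ?_) _
    intro t
    rw [abs_of_nonneg (cellInd_nonneg i t)]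
    exact cellInd_le_one i t

lemma tendsto_integral_stepFun (hT : 0 < T) {x : ℝ → ℝ} (hx : ∀ t, |x t| ≤ 1)
    (hxc : ∀ t, ContinuousWithinAt x (Set.Ici t) t) :
    Tendsto (fun n => ∫ t, stepFun T n x t ∂(boxMeasure T)) atTop
      (𝓝 (∫ t, x t ∂(boxMeasure T))) := by
  refine tendsto_integral_of_dominated_convergence (fun _ => 1)
    (fun n => (measurable_stepFun x).aestronglyMeasurable) (integrable_const _) (fun n => ?_) ?_
  · filter_upwards [ae_boxMeasure] with t ht using abs_stepFun_le hT ht n hx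
  · filter_upwards [ae_boxMeasure] with t ht using tendsto_stepFun hT ht (hxc t)

variable {W : ℝ → ℝ}

lemma integrable_kernel (hW : Continuous W) :
    Integrable (fun p : ℝ × ℝ => W (p.1 - p.2)) ((boxMeasure T).prod (boxMeasure T)) := by
  have h : (boxMeasure T).prod (boxMeasure T) =
      (volume.prod volume).restrict (Set.Ioc (-T) T ×ˢ Set.Ioc (-T) T) :=
    Measure.prod_restrict _ _
  rw [h]
  have h2 : IntegrableOn (fun p : ℝ × ℝ => W (p.1 - p.2)) (Set.Icc (-T) T ×ˢ Set.Icc (-T) T)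
      (volume.prod volume) :=
    (by fun_prop : Continuous fun p : ℝ × ℝ => W (p.1 - p.2)).continuousOn.integrableOn_compact
      (isCompact_Icc.prod isCompact_Icc)
  exact h2.mono_set (Set.prod_mono Set.Ioc_subset_Icc_self Set.Ioc_subset_Icc_self)

lemma integrable_kernel_mul (hW : Continuous W) {x y : ℝ → ℝ} (hx : Measurable x)
    (hy : Measurable y) (hx1 : ∀ t, |x t| ≤ 1) (hy1 : ∀ t, |y t| ≤ 1) :
    Integrable (fun p : ℝ × ℝ => W (p.1 - p.2) * x p.1 * y p.2)
      ((boxMeasure T).prod (boxMeasure T)) := by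
  refine (integrable_kernel hW).mono ?_ (.of_forall fun p => ?_)
  · exact ((hW.measurable.comp (measurable_fst.sub measurable_snd)).mul
      (hx.comp measurable_fst)).mul (hy.comp measurable_snd) |>.aestronglyMeasurable
  · rw [norm_mul, norm_mul, mul_assoc]
    exact mul_le_of_le_one_right (norm_nonneg _)
      (mul_le_one₀ (hx1 _) (norm_nonneg _) (hy1 _))

/-- The effective coupling of the cells `i` and `j`. -/
noncomputable def cellCoupling (W : ℝ → ℝ) (T : ℝ) (n : ℕ) (i j : Fin (n + 1)) : ℝ :=
  ∫ p : ℝ × ℝ, W (p.1 - p.2) * cellInd T n i p.1 * cellInd T n j p.2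
    ∂((boxMeasure T).prod (boxMeasure T))

lemma abs_cellInd_le (i : Fin (n + 1)) (t : ℝ) : |cellInd T n i t| ≤ 1 := by
  rw [abs_of_nonneg (cellInd_nonneg i t)]
  exact cellInd_le_one i t

lemma integral_kernel_stepFun (hW : Continuous W) (x : ℝ → ℝ) :
    ∫ p : ℝ × ℝ, W (p.1 - p.2) * stepFun T n x p.1 * stepFun T n x p.2
      ∂((boxMeasure T).prod (boxMeasure T)) =
    ∑ i, ∑ j, cellCoupling W T n i j * (x (gridPoint T n i) * x (gridPoint T n j)) := by
  have h1 : ∀ p : ℝ × ℝ, W (p.1 - p.2) * stepFun T n x p.1 * stepFun T n x p.2 =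
      ∑ i, ∑ j, (W (p.1 - p.2) * cellInd T n i p.1 * cellInd T n j p.2) *
        (x (gridPoint T n i) * x (gridPoint T n j)) := by
    intro p
    rw [mul_assoc, stepFun, stepFun, Finset.sum_mul_sum, Finset.mul_sum]
    refine Finset.sum_congr rfl fun i _ => ?_
    rw [Finset.mul_sum]
    refine Finset.sum_congr rfl fun j _ => by ring
  have hint : ∀ i j, Integrable (fun p : ℝ × ℝ =>
      (W (p.1 - p.2) * cellInd T n i p.1 * cellInd T n j p.2) *
        (x (gridPoint T n i) * x (gridPoint T n j))) ((boxMeasure T).prod (boxMeasure T)) :=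
    fun i j => (integrable_kernel_mul hW (measurable_cellInd i) (measurable_cellInd j)
      (abs_cellInd_le i) (abs_cellInd_le j)).mul_const _
  simp only [h1]
  rw [integral_finsetSum _ fun i _ => integrable_finsetSum _ fun j _ => hint i j]
  refine Finset.sum_congr rfl fun i _ => ?_
  rw [integral_finsetSum _ fun j _ => hint i j]
  refine Finset.sum_congr rfl fun j _ => ?_
  rw [integral_mul_const, cellCoupling]

lemma tendsto_integral_kernel_stepFun (hT : 0 < T) (hW : Continuous W) {x : ℝ → ℝ}
    (hx : ∀ t, |x t| ≤ 1) (hxc : ∀ t, ContinuousWithinAt x (Set.Ici t) t) :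
    Tendsto (fun n => ∫ p : ℝ × ℝ, W (p.1 - p.2) * stepFun T n x p.1 * stepFun T n x p.2
      ∂((boxMeasure T).prod (boxMeasure T))) atTop
      (𝓝 (∫ p : ℝ × ℝ, W (p.1 - p.2) * x p.1 * x p.2 ∂((boxMeasure T).prod (boxMeasure T)))) := by
  refine tendsto_integral_of_dominated_convergence (fun p => ‖W (p.1 - p.2)‖)
    (fun n => ?_) (integrable_kernel hW).norm (fun n => ?_) ?_
  · exact (((hW.measurable.comp (measurable_fst.sub measurable_snd)).mul
      ((measurable_stepFun x).comp measurable_fst)).mul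
        ((measurable_stepFun x).comp measurable_snd)).aestronglyMeasurable
  · filter_upwards [ae_boxMeasure_prod] with p hp
    rw [norm_mul, norm_mul, mul_assoc]
    exact mul_le_of_le_one_right (norm_nonneg _)
      (mul_le_one₀ (abs_stepFun_le hT hp.1 n hx) (norm_nonneg _) (abs_stepFun_le hT hp.2 n hx))
  · filter_upwards [ae_boxMeasure_prod] with p hp
    exact ((tendsto_stepFun hT hp.1 (hxc _)).const_mul _).mul (tendsto_stepFun hT hp.2 (hxc _))

lemma abs_integral_kernel_le {x : ℝ → ℝ} (hW : Continuous W)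
    (hx : ∀ t ∈ Set.Ioc (-T) T, |x t| ≤ 1) :
    |∫ p : ℝ × ℝ, W (p.1 - p.2) * x p.1 * x p.2 ∂((boxMeasure T).prod (boxMeasure T))| ≤
      ∫ p : ℝ × ℝ, ‖W (p.1 - p.2)‖ ∂((boxMeasure T).prod (boxMeasure T)) := by
  rw [← Real.norm_eq_abs]
  refine norm_integral_le_of_norm_le (integrable_kernel hW).norm ?_
  filter_upwards [ae_boxMeasure_prod] with p hp
  rw [norm_mul, norm_mul, mul_assoc]
  exact mul_le_of_le_one_right (norm_nonneg _)
    (mul_le_one₀ (hx _ hp.1) (norm_nonneg _) (hx _ hp.2))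

lemma cellCoupling_nonneg (hW0 : ∀ t, 0 ≤ W t) (i j : Fin (n + 1)) :
    0 ≤ cellCoupling W T n i j :=
  integral_nonneg fun _ => mul_nonneg (mul_nonneg (hW0 _) (cellInd_nonneg _ _)) (cellInd_nonneg _ _)

lemma cellCoupling_symm (hWe : ∀ t, W (-t) = W t) (i j : Fin (n + 1)) :
    cellCoupling W T n j i = cellCoupling W T n i j := by
  rw [cellCoupling, ← integral_prod_swap, cellCoupling]
  refine integral_congr_ae (.of_forall fun p => ?_)
  simp only [Prod.fst_swap, Prod.snd_swap]
  rw [← neg_sub, hWe]; ring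

/-- The cells partition the interval, so summing over `j` removes the second indicator. The
remaining integral of `W (t - s)` in `s` is at most `‖W‖₁` by translation invariance, and the cell
has length `mesh T n`. -/
lemma sum_cellCoupling_le (hT : 0 < T) (hW : Continuous W) (hW0 : ∀ t, 0 ≤ W t)
    (hWi : Integrable W volume) (i : Fin (n + 1)) :
    ∑ j, cellCoupling W T n i j ≤ mesh T n * ∫ t, ‖W t‖ := by
  have hint : ∀ j : Fin (n + 1), Integrable (fun p : ℝ × ℝ =>
      W (p.1 - p.2) * cellInd T n i p.1 * cellInd T n j p.2)
        ((boxMeasure T).prod (boxMeasure T)) :=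
    fun j => integrable_kernel_mul hW (measurable_cellInd i) (measurable_cellInd j)
      (abs_cellInd_le i) (abs_cellInd_le j)
  have h1 : ∑ j, cellCoupling W T n i j = ∫ p : ℝ × ℝ, W (p.1 - p.2) * cellInd T n i p.1 * 1
      ∂((boxMeasure T).prod (boxMeasure T)) := by
    simp only [cellCoupling]
    rw [← integral_finsetSum _ fun j _ => hint j]
    refine integral_congr_ae ?_
    filter_upwards [ae_boxMeasure_prod] with p hp
    rw [← Finset.mul_sum, sum_cellInd hT hp.2]
  have hint2 := integrable_kernel_mul (T := T) hW (measurable_cellInd (T := T) i) measurable_const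
    (abs_cellInd_le i) (fun _ => (abs_one (α := ℝ)).le)
  rw [h1, integral_prod _ hint2, ← integral_cellInd hT i, ← integral_mul_const]
  refine integral_mono hint2.integral_prod_left
    ((integrable_of_bound (measurable_cellInd i) (abs_cellInd_le i)).mul_const _) fun t => ?_
  have h2 : ∀ s, W (t - s) * cellInd T n i t * 1 = cellInd T n i t * W (t - s) := fun s => by ring
  simp only [h2]
  rw [integral_const_mul]
  refine mul_le_mul_of_nonneg_left ?_ (cellInd_nonneg i t)
  rw [← integral_sub_left_eq_self (fun s => ‖W s‖) volume t]
  have h3 : ∀ s, ‖W s‖ = W s := fun s => Real.norm_of_nonneg (hW0 s)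
  simp only [h3]
  exact setIntegral_le_integral (hWi.comp_sub_left t) (.of_forall fun s => hW0 _)

end Discretization

/-! ### Uniform bounds and passage to the continuum. -/

section Main

variable {Ω : Type*} {N : ℝ → Ω → ℤ} {B : Ω → ℝ} {T : ℝ} {W : ℝ → ℝ}

/-- The jump process with values `±1` at every point of the sample space. -/
noncomputable def signPath (N : ℝ → Ω → ℤ) (B : Ω → ℝ) (t : ℝ) (ω : Ω) : ℝ :=
  ((unitProcess N B t ω : ℤ) : ℝ)

lemma abs_signPath (t : ℝ) (ω : Ω) : |signPath N B t ω| = 1 := by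
  rw [signPath]
  rcases Int.units_eq_one_or (unitProcess N B t ω) with h | h <;> simp [h]

lemma interaction_eq_integral_prod (hT : 0 < T) (hW : Continuous W) {X : ℝ → Ω → ℝ} {ω : Ω}
    (hX : Measurable fun t => X t ω) (hX1 : ∀ t, |X t ω| ≤ 1) :
    interaction W X T ω = ∫ p : ℝ × ℝ, W (p.1 - p.2) * X p.1 ω * X p.2 ω
      ∂((boxMeasure T).prod (boxMeasure T)) := by
  rw [integral_prod _ (integrable_kernel_mul hW hX hX hX1 hX1), interaction,
    intervalIntegral.integral_of_le (by linarith)]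
  refine integral_congr_ae (.of_forall fun t => ?_)
  simp only [intervalIntegral.integral_of_le (show -T ≤ T by linarith)]
  rfl

/-- The discretized interaction. -/
noncomputable def gridInteraction (N : ℝ → Ω → ℤ) (B : Ω → ℝ) (W : ℝ → ℝ) (T : ℝ) (n : ℕ)
    (ω : Ω) : ℝ :=
  ∑ i, ∑ j, cellCoupling W T n i j *
    (signPath N B (gridPoint T n i) ω * signPath N B (gridPoint T n j) ω)

/-- The discretized magnetization. -/
noncomputable def gridMagnetization (N : ℝ → Ω → ℤ) (B : Ω → ℝ) (T : ℝ) (n : ℕ) (ω : Ω) : ℝ :=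
  mesh T n * ∑ i, signPath N B (gridPoint T n i) ω

/-- The grid interaction is the double integral of a step function bounded by 1; the bound is
uniform in `n` and `ω`, as dominated convergence requires. -/
lemma abs_gridInteraction_le (hT : 0 < T) (hW : Continuous W) (n : ℕ) (ω : Ω) :
    |gridInteraction N B W T n ω| ≤
      ∫ p : ℝ × ℝ, ‖W (p.1 - p.2)‖ ∂((boxMeasure T).prod (boxMeasure T)) := by
  rw [gridInteraction, ← integral_kernel_stepFun hW (fun t => signPath N B t ω)]
  exact abs_integral_kernel_le hW fun t ht =>
    abs_stepFun_le hT ht n fun t => (abs_signPath t ω).le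

lemma abs_gridMagnetization_le (hT : 0 < T) (n : ℕ) (ω : Ω) :
    |gridMagnetization N B T n ω| ≤ 2 * T := by
  rw [gridMagnetization, abs_mul, abs_of_pos (mesh_pos hT), ← mesh_mul (n := n), mul_comm]
  refine mul_le_mul_of_nonneg_right ?_ (mesh_pos hT).le
  refine (Finset.abs_sum_le_sum_abs _ _).trans ?_
  simp [abs_signPath]

variable [MeasurableSpace Ω] {P : Measure Ω}

lemma IsTwoSidedPoisson.ae_path (hN : IsTwoSidedPoisson N P) :
    ∀ᵐ ω ∂P, (Measurable fun t => signPath N B t ω) ∧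
      ∀ t, ContinuousWithinAt (fun t => signPath N B t ω) (Set.Ici t) t := by
  filter_upwards [hN.path_monotone, hN.path_rightContinuous] with ω h1 h2
  have h : (fun t => signPath N B t ω) =
      (fun k : ℤ => ((unitSign B ω * k.negOnePow : ℤˣ) : ℝ)) ∘ fun t => N t ω := rfl
  rw [h]
  refine ⟨(measurable_of_countable _).comp h1.measurable, fun t => ?_⟩
  exact continuous_of_discreteTopology.continuousAt.comp_continuousWithinAt (h2 t)

variable [IsProbabilityMeasure P]

/-- Almost every path of the jump process is measurable, bounded, and approximated by its
discretizations. -/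
lemma ae_regular (hN : IsTwoSidedPoisson N P) (hB : IsRandomSign B P) (hW : Continuous W)
    (hT : 0 < T) : ∀ᵐ ω ∂P, (Measurable fun t => jumpProcess N B t ω) ∧
      (∀ t, |(jumpProcess N B t ω)| ≤ 1) ∧
      Tendsto (fun n => gridInteraction N B W T n ω) atTop
        (𝓝 (interaction W (jumpProcess N B) T ω)) ∧
      Tendsto (fun n => gridMagnetization N B T n ω) atTop
        (𝓝 (∫ t in (-T)..T, jumpProcess N B t ω)) := by
  filter_upwards [hN.ae_path (B := B), hB.ae_jumpProcess_eq (N := N)] with ω hω hX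
  have hX' : (fun t => jumpProcess N B t ω) = fun t => signPath N B t ω := funext hX
  have h1 : ∀ t, |signPath N B t ω| ≤ 1 := fun t => (abs_signPath t ω).le
  have hm : Measurable fun t => jumpProcess N B t ω := hX' ▸ hω.1
  have hb : ∀ t, |(jumpProcess N B t ω)| ≤ 1 := fun t => by
    rw [show jumpProcess N B t ω = signPath N B t ω from hX t]; exact h1 t
  refine ⟨hm, hb, ?_, ?_⟩
  · rw [interaction_eq_integral_prod hT hW hm hb]
    have := tendsto_integral_kernel_stepFun hT hW h1 hω.2
    simp only [integral_kernel_stepFun hW] at this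
    simp only [show ∀ t, jumpProcess N B t ω = signPath N B t ω from hX]
    exact this
  · rw [hX', intervalIntegral.integral_of_le (by linarith)]
    have := tendsto_integral_stepFun hT h1 hω.2
    simp only [integral_stepFun hT] at this
    exact this

lemma measurable_gridInteraction (hN : IsTwoSidedPoisson N P) (hB : IsRandomSign B P) (n : ℕ) :
    Measurable (gridInteraction N B W T n) :=
  measurable_comp_unitProcess hN hB (gridPoint T n) fun σ =>
    ∑ i, ∑ j, cellCoupling W T n i j * (((σ i : ℤ) : ℝ) * ((σ j : ℤ) : ℝ))

lemma measurable_gridMagnetization (hN : IsTwoSidedPoisson N P) (hB : IsRandomSign B P) (n : ℕ) :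
    Measurable (gridMagnetization N B T n) :=
  measurable_comp_unitProcess hN hB (gridPoint T n) fun σ => mesh T n * ∑ i, ((σ i : ℤ) : ℝ)

lemma integrable_of_tendsto_bounded {f : ℕ → Ω → ℝ} {g : Ω → ℝ} {c : ℝ}
    (hf : ∀ n, AEStronglyMeasurable (f n) P) (hb : ∀ n ω, |f n ω| ≤ c)
    (hl : ∀ᵐ ω ∂P, Tendsto (fun n => f n ω) atTop (𝓝 (g ω))) :
    Integrable g P ∧ Tendsto (fun n => ∫ ω, f n ω ∂P) atTop (𝓝 (∫ ω, g ω ∂P)) := by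
  refine ⟨Integrable.of_bound (aestronglyMeasurable_of_tendsto_ae atTop hf hl) c ?_,
    tendsto_integral_of_dominated_convergence (fun _ => c) hf (integrable_const c)
      (fun n => .of_forall (hb n)) hl⟩
  filter_upwards [hl] with ω hω
  exact le_of_tendsto hω.norm (.of_forall fun n => hb n ω)

lemma gridMagnetization_bound (hN : IsTwoSidedPoisson N P) (hB : IsRandomSign B P)
    (hI : IndepFun B (fun ω t => N t ω) P) (hT : 0 < T) (hW : Continuous W)
    (hWe : ∀ t, W (-t) = W t) (hW0 : ∀ t, 0 ≤ W t) (hWi : Integrable W volume)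
    (hWn : ∫ t, ‖W t‖ ≤ 1 / 16) {n : ℕ} (hn : mesh T n ≤ 1 / 2) :
    ∫ ω, gridMagnetization N B T n ω ^ 2 * Real.exp (gridInteraction N B W T n ω) ∂P ≤
      8 * T * ∫ ω, Real.exp (gridInteraction N B W T n ω) ∂P := by
  set δ := mesh T n
  have hδ : 0 < δ := mesh_pos hT
  -- `1 - exp (-2δ) ≥ 2δ / (1 + 2δ) ≥ δ`; the last inequality is where `δ ≤ 1/2` enters.
  have hexp : δ ≤ 1 - Real.exp (-2 * δ) := by
    have h1 := Real.add_one_le_exp (2 * δ)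
    have h2 : Real.exp (-2 * δ) * Real.exp (2 * δ) = 1 := by rw [← Real.exp_add]; simp
    nlinarith [Real.exp_pos (-2 * δ)]
  -- Row and column sums agree as `W` is even, and each is at most `δ / 16`. With `κ = δ / 8`, the
  -- condition `8 κ ≤ 1 - exp (-2δ)` is exactly `hexp`; this fixes `1 / 16`.
  have hκ : ∀ i, ∑ j, cellCoupling W T n i j + ∑ j, cellCoupling W T n j i ≤ δ / 8 := by
    intro i
    simp only [cellCoupling_symm hWe]
    have := sum_cellCoupling_le (n := n) hT hW hW0 hWi i
    nlinarith
  have h := integral_sq_mul_exp_le hN hB hI hδ gridPoint_sub (cellCoupling_nonneg hW0) hκ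
    (by linarith)
  have h1 : ∀ ω, gridMagnetization N B T n ω ^ 2 * Real.exp (gridInteraction N B W T n ω) =
      δ ^ 2 * ((∑ i, ((unitProcess N B (gridPoint T n i) ω : ℤ) : ℝ)) ^ 2 *
        Real.exp (gridInteraction N B W T n ω)) := fun ω => by
    simp only [gridMagnetization, signPath]; ring
  simp only [h1]
  rw [integral_const_mul]
  refine (mul_le_mul_of_nonneg_left h (sq_nonneg δ)).trans ?_
  rw [← mul_assoc]
  refine mul_le_mul_of_nonneg_right ?_ (integral_nonneg fun ω => (Real.exp_pos _).le)
  have hmul : ((n : ℝ) + 1) * δ = 2 * T := mesh_mul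
  have h2 : δ * (4 / (1 - Real.exp (-2 * δ))) ≤ 4 := by
    rw [← mul_div_assoc, div_le_iff₀ (by linarith)]; linarith
  calc δ ^ 2 * (((n + 1 : ℕ) : ℝ) * (4 / (1 - Real.exp (-2 * δ))))
      = (((n : ℝ) + 1) * δ) * (δ * (4 / (1 - Real.exp (-2 * δ)))) := by push_cast; ring
    _ ≤ (2 * T) * 4 := by rw [hmul]; gcongr
    _ = 8 * T := by ring

lemma integrable_and_susceptibility_le (hN : IsTwoSidedPoisson N P) (hB : IsRandomSign B P)
    (hI : IndepFun B (fun ω t => N t ω) P) (hT : 0 < T) (hW : Continuous W)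
    (hWe : ∀ t, W (-t) = W t) (hW0 : ∀ t, 0 ≤ W t) (hWi : Integrable W volume)
    (hWn : ∫ t, ‖W t‖ ≤ 1 / 16) :
    Integrable (fun ω => Real.exp (interaction W (jumpProcess N B) T ω)) P ∧
      Integrable (weightedSquare W (jumpProcess N B) T) P ∧
      0 < partitionFunction P W (jumpProcess N B) T ∧
      susceptibility P W (jumpProcess N B) T ≤ 8 := by
  set c := ∫ p : ℝ × ℝ, ‖W (p.1 - p.2)‖ ∂((boxMeasure T).prod (boxMeasure T))
  have hreg := ae_regular hN hB hW hT
  have hmI := fun n => (measurable_gridInteraction (W := W) (T := T) hN hB n)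
  have hmS := fun n => (measurable_gridMagnetization (T := T) hN hB n)
  have hexp_le : ∀ n ω, Real.exp (gridInteraction N B W T n ω) ≤ Real.exp c := fun n ω =>
    Real.exp_le_exp.2 ((le_abs_self _).trans (abs_gridInteraction_le hT hW n ω))
  obtain ⟨hZi, hZt⟩ := integrable_of_tendsto_bounded (P := P) (c := Real.exp c)
    (f := fun n ω => Real.exp (gridInteraction N B W T n ω))
    (g := fun ω => Real.exp (interaction W (jumpProcess N B) T ω))
    (fun n => (hmI n).exp.aestronglyMeasurable)
    (fun n ω => by rw [abs_of_pos (Real.exp_pos _)]; exact hexp_le n ω)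
    (hreg.mono fun ω h => (Real.continuous_exp.tendsto _).comp h.2.2.1)
  obtain ⟨hMi, hMt⟩ := integrable_of_tendsto_bounded (P := P) (c := (2 * T) ^ 2 * Real.exp c)
    (f := fun n ω => gridMagnetization N B T n ω ^ 2 * Real.exp (gridInteraction N B W T n ω))
    (g := fun ω => (∫ t in (-T)..T, jumpProcess N B t ω) ^ 2 *
      Real.exp (interaction W (jumpProcess N B) T ω))
    (fun n => (((hmS n).pow_const 2).mul (hmI n).exp).aestronglyMeasurable)
    (fun n ω => by
      rw [abs_mul, abs_pow, abs_of_pos (Real.exp_pos _)]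
      gcongr
      · exact abs_gridMagnetization_le hT n ω
      · exact Real.exp_le_exp.1 (hexp_le n ω))
    (hreg.mono fun ω h => (h.2.2.2.pow 2).mul ((Real.continuous_exp.tendsto _).comp h.2.2.1))
  have hZ : 0 < partitionFunction P W (jumpProcess N B) T := integral_exp_pos hZi
  have hws : weightedSquare W (jumpProcess N B) T = fun ω => 1 / T *
      ((∫ t in (-T)..T, jumpProcess N B t ω) ^ 2 *
        Real.exp (interaction W (jumpProcess N B) T ω)) := by
    funext ω; rw [weightedSquare, mul_assoc]
  refine ⟨hZi, hws ▸ hMi.const_mul _, hZ, ?_⟩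
  have hlim : ∫ ω, (∫ t in (-T)..T, jumpProcess N B t ω) ^ 2 *
      Real.exp (interaction W (jumpProcess N B) T ω) ∂P ≤
        8 * T * partitionFunction P W (jumpProcess N B) T := by
    -- The grid bound holds once the mesh is at most `1 / 2`, with a constant free of `n`, so it
    -- survives the limit.
    refine le_of_tendsto_of_tendsto hMt (hZt.const_mul (8 * T)) ?_
    filter_upwards [(tendsto_mesh (T := T)).eventually (ge_mem_nhds (by norm_num : (0 : ℝ) < 1 / 2))]
      with n hn
    exact gridMagnetization_bound hN hB hI hT hW hWe hW0 hWi hWn hn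
  rw [susceptibility, hws, integral_const_mul, one_div_mul_eq_div, div_le_iff₀ hZ,
    one_div_mul_eq_div, div_le_iff₀ hT]
  linarith

end Main

end JumpIsing

theorem theorem1 :
    ∃ ε : ℝ, 0 < ε ∧ ∃ C : ℝ, 0 < C ∧
      ∀ (Ω : Type*) [MeasurableSpace Ω] (P : Measure Ω) [IsProbabilityMeasure P]
        (N : ℝ → Ω → ℤ) (B : Ω → ℝ),
        JumpIsing.IsTwoSidedPoisson N P → JumpIsing.IsRandomSign B P →
        IndepFun B (fun ω t => N t ω) P →
        ∀ W : ℝ → ℝ, Continuous W → (∀ t, W (-t) = W t) → (∀ t, 0 ≤ W t) →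
          Integrable W volume → (∫ t, ‖W t‖) ≤ ε →
          -- all the integrals involved are well defined, and `Z(W, T) > 0`
          (∀ T : ℝ, 0 < T →
            (∀ᵐ ω ∂P, IntervalIntegrable
              (fun t => JumpIsing.jumpProcess N B t ω) volume (-T) T) ∧
            (∀ᵐ ω ∂P, Integrable
              (fun p : ℝ × ℝ => W (p.1 - p.2) * JumpIsing.jumpProcess N B p.1 ω *
                JumpIsing.jumpProcess N B p.2 ω)
              ((volume.restrict (Set.Ioc (-T) T)).prod (volume.restrict (Set.Ioc (-T) T)))) ∧
            Integrable
              (fun ω => Real.exp (JumpIsing.interaction W (JumpIsing.jumpProcess N B) T ω)) P ∧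
            Integrable (JumpIsing.weightedSquare W (JumpIsing.jumpProcess N B) T) P ∧
            0 < JumpIsing.partitionFunction P W (JumpIsing.jumpProcess N B) T) ∧
          -- the bound, with the upper limit taken in the extended reals
          limsup (fun T : ℝ =>
            ((JumpIsing.susceptibility P W (JumpIsing.jumpProcess N B) T : ℝ) : EReal)) atTop
            ≤ (C : EReal) := by
  refine ⟨1 / 16, by norm_num, 8, by norm_num, ?_⟩
  intro Ω _ P _ N B hN hB hI W hW hWe hW0 hWi hWn
  refine ⟨fun T hT => ?_, ?_⟩
  · have hreg := JumpIsing.ae_regular hN hB hW hT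
    obtain ⟨h1, h2, h3, -⟩ :=
      JumpIsing.integrable_and_susceptibility_le hN hB hI hT hW hWe hW0 hWi hWn
    refine ⟨hreg.mono fun ω h => ?_, hreg.mono fun ω h => ?_, h1, h2, h3⟩
    · rw [intervalIntegrable_iff_integrableOn_Ioc_of_le (by linarith)]
      exact JumpIsing.integrable_of_bound h.1 h.2.1
    · exact JumpIsing.integrable_kernel_mul hW h.1 h.1 h.2.1 h.2.1
  -- The bound by 8 already holds for each `T > 0`, hence for the upper limit.
  · refine limsup_le_of_le (by isBoundedDefault) ?_
    filter_upwards [eventually_gt_atTop 0] with T hT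
    exact EReal.coe_le_coe_iff.2
      (JumpIsing.integrable_and_susceptibility_le hN hB hI hT hW hWe hW0 hWi hWn).2.2.2
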